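/- \textbf{Setting.} Let $\mathcal A$ be a C*-algebra, $G$ a locally compact (Hausdorff) group with a fixed left Haar measure, and $\alpha:G\to\mathrm{Aut}(\mathcal A)$ a group homomorphism; no continuity of $\alpha$ is assumed. The triple $(\mathcal A,G,\alpha)$ is called a C*-action. Let $\mathcal L=C^*(G)$ be the full group C*-algebra and $\eta:G\to U(M(\mathcal L))$ the canonical map. For a strongly continuous unitary representation $U$ of $G$, let $U_{\mathcal L}$ be the corresponding representation of $\mathcal L$, so that $U_{\mathcal L}(f)=\int_G f(g)U_g\,dg$ for $f\in C_c(G)$. A covariant representation $(\pi,U)$ on a Hilbert space $\mathcal H$ consists of a $*$-representation $\pi$ of $\mathcal A$ and a strongly continuous unitary representation $U$ of $G$ on $\mathcal H$ with $U_g\pi(A)U_g^*=\pi(\alpha_g(A))$ for all $g\in G$, $A\in\mathcal A$. \textbf{Full crossed product host.} A crossed product host for $(\mathcal A,G,\alpha)$ is a C*-algebra $\mathcal C$ with $*$-homomorphisms $\eta_{\mathcal A}:\mathcal A\to M(\mathcal C)$ and $\eta_{\mathcal L}:\mathcal L\to M(\mathcal C)$ such that: $\eta_{\mathcal L}(\mathcal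 L)\mathcal C$ spans a dense subspace of $\mathcal C$; the extension $\widetilde\eta_{\mathcal L}:M(\mathcal L)\to M(\mathcal C)$ satisfies $\widetilde\eta_{\mathcal L}(\eta(g))\eta_{\mathcal A}(A)\widetilde\eta_{\mathcal L}(\eta(g))^*=\eta_{\mathcal A}(\alpha_g(A))$ for all $g\in G$, $A\in\mathcal A$; and $\eta_{\mathcal A}(\mathcal A)\eta_{\mathcal L}(\mathcal L)$ is contained in $\mathcal C$ and generates it as a C*-algebra. It is full if for every covariant representation $(\pi,U)$ with $\pi$ non-degenerate there is a unique representation $\rho$ of $\mathcal C$ with $\rho(\eta_{\mathcal A}(A)\eta_{\mathcal L}(L))=\pi(A)U_{\mathcal L}(L)$ for all $A\in\mathcal A$, $L\in\mathcal L$. \textbf{Regular representation.} Let $(\pi_u,\mathcal H_u)$ be the universal representation of $\mathcal A$, the direct sum of the GNS representations of all states. On $L^2(G,\mathcal H_u)$ put $(\lambda_h\xi)(g)=\xi(h^{-1}g)$ and $(\widetilde\pi_u(A)\xi)(g)=\pi_u(\alpha_{g^{-1}}(A))\xi(g)$. As $\alpha$ need not be continuous, the function $g\mapsto\pi_u(\alpha_{g^{-1}}(A))\xi(g)$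 may fail to be measurable for some $\xi$; so $\widetilde\pi_u(A)$ is taken on the subspace $\mathrm{dom}\,\widetilde\pi_u(A)$ of those $\xi\in L^2(G,\mathcal H_u)$ for which it is strongly measurable, and $$\|\widetilde\pi_u(A)\lambda_{\mathcal L}(L)\|:=\sup\{\|\widetilde\pi_u(A)\lambda_{\mathcal L}(L)\xi\| : \xi\in L^2(G,\mathcal H_u),\ \|\xi\|\le1,\ \lambda_{\mathcal L}(L)\xi\in\mathrm{dom}\,\widetilde\pi_u(A)\}.$$ This is the usual operator norm whenever $\widetilde\pi_u(A)$ is everywhere defined, e.g. when $g\mapsto\alpha_g(A)$ is norm continuous. \textbf{Lemma.} Suppose that the C*-action $(\mathcal A,G,\alpha)$ has a full crossed product host and that $G$ is amenable. Then for every covariant representation $(\pi,U)$ of $(\mathcal A,G,\alpha)$, $$\|\pi(A)U_{\mathcal L}(L)\|\le\|\widetilde\pi_u(A)\lambda_{\mathcal L}(L)\|\qquad\text{for all }A\in\mathcal A,\ L\in\mathcal L.$$ -/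

import Mathlib

set_option linter.unusedSectionVars false

open MeasureTheory Measure
open scoped ENNReal MultiplierAlgebra ComplexOrder

universe u v

noncomputable section

namespace CrossedHost

/-! ### Unitary representations and the full group C*-algebra -/

section Group

variable (G : Type u) [Group G] [TopologicalSpace G]

/-- A strongly continuous unitary representation of `G` on the Hilbert space `H`. -/
structure UnitaryRep (H : Type u) [NormedAddCommGroup H] [InnerProductSpace ℂ H]
    [CompleteSpace H] where
  /-- the homomorphism into the unitary group of `H` -/
  U : G →* unitary (H →L[ℂ] H)
  strong_continuous : ∀ ξ : H, Continuous fun g : G => (U g : H →L[ℂ] H) ξ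

/-- All strongly continuous unitary representations of `G`, on all Hilbert spaces. -/
structure BundledRep : Type (u + 1) where
  /-- the Hilbert space -/
  H : Type u
  [normed : NormedAddCommGroup H]
  [inner : InnerProductSpace ℂ H]
  [complete : CompleteSpace H]
  /-- the representation -/
  rep : UnitaryRep G H

attribute [instance] BundledRep.normed BundledRep.inner BundledRep.complete

/-- The C*-algebra of bounded families of operators, one for each unitary representation. -/
def BddFamilies : Type (u + 1) := lp (fun i : BundledRep G => i.H →L[ℂ] i.H) ∞

instance : NonUnitalCStarAlgebra (BddFamilies G) :=
  inferInstanceAs (NonUnitalCStarAlgebra (lp (fun i : BundledRep G => i.H →L[ℂ] i.H) ∞))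

/-- The bounded family with components `T i`. -/
def BddFamilies.mk (T : ∀ i : BundledRep G, i.H →L[ℂ] i.H) (C : ℝ) (hT : ∀ i, ‖T i‖ ≤ C) :
    BddFamilies G :=
  ⟨T, memℓp_infty ⟨C, by rintro _ ⟨i, rfl⟩; exact hT i⟩⟩

/-- The component of a bounded family at `i`. -/
def BddFamilies.proj (i : BundledRep G) : BddFamilies G →⋆ₙₐ[ℂ] (i.H →L[ℂ] i.H) where
  toFun x := x.1 i
  map_smul' _ _ := rfl
  map_zero' := rfl
  map_add' _ _ := rfl
  map_mul' _ _ := rfl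
  map_star' _ := rfl

variable {G} in
lemma BddFamilies.ext {x y : BddFamilies G}
    (h : ∀ i, BddFamilies.proj G i x = BddFamilies.proj G i y) : x = y :=
  Subtype.ext (funext h)

/-- A locally compact group is amenable if the bounded continuous functions carry a
left-invariant mean. -/
def IsAmenable [IsTopologicalGroup G] : Prop :=
  ∃ m : BoundedContinuousFunction G ℝ →ₗ[ℝ] ℝ,
    (∀ f : BoundedContinuousFunction G ℝ, (∀ g, 0 ≤ f g) → 0 ≤ m f) ∧
    m (BoundedContinuousFunction.const G 1) = 1 ∧
    ∀ (h : G) (f : BoundedContinuousFunction G ℝ),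
      m (f.compContinuous ⟨fun g => h⁻¹ * g, continuous_const_mul h⁻¹⟩) = m f

variable {G}

lemma norm_unitary_apply {H : Type u} [NormedAddCommGroup H] [InnerProductSpace ℂ H]
    [CompleteSpace H] (w : unitary (H →L[ℂ] H)) (ξ : H) : ‖(w : H →L[ℂ] H) ξ‖ = ‖ξ‖ :=
  ContinuousLinearMap.norm_map_of_mem_unitary w.2 ξ

variable [IsTopologicalGroup G] [LocallyCompactSpace G] [MeasurableSpace G] [BorelSpace G]

namespace UnitaryRep

variable {H : Type u} [NormedAddCommGroup H] [InnerProductSpace ℂ H] [CompleteSpace H]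

lemma integrable_smul (W : UnitaryRep G H) (f : CompactlySupportedContinuousMap G ℂ) (ξ : H) :
    Integrable (fun g => f g • (W.U g : H →L[ℂ] H) ξ) (haar : Measure G) :=
  (f.continuous.smul (W.strong_continuous ξ)).integrable_of_hasCompactSupport
    f.hasCompactSupport.smul_right

lemma integrable_coe (f : CompactlySupportedContinuousMap G ℂ) :
    Integrable (fun g => f g) (haar : Measure G) :=
  f.continuous.integrable_of_hasCompactSupport f.hasCompactSupport

/-- The operator `∫ f(g) U_g dg` for `f ∈ C_c(G)`, with respect to left Haar measure. -/
def integrated (W : UnitaryRep G H) (f : CompactlySupportedContinuousMap G ℂ) : H →L[ℂ] H :=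
  LinearMap.mkContinuous
    { toFun := fun ξ => ∫ g, f g • (W.U g : H →L[ℂ] H) ξ ∂(haar : Measure G)
      map_add' := fun ξ ζ => by
        simp only [map_add, smul_add]
        exact integral_add (W.integrable_smul f ξ) (W.integrable_smul f ζ)
      map_smul' := fun c ξ => by
        simp only [map_smul, RingHom.id_apply]
        rw [← integral_smul]
        exact integral_congr_ae (.of_forall fun g => smul_comm _ _ _) }
    (∫ g, ‖f g‖ ∂(haar : Measure G)) fun ξ => by
      refine (norm_integral_le_integral_norm _).trans (le_of_eq ?_)
      simp only [norm_smul, norm_unitary_apply]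
      exact integral_mul_const _ _

lemma integrated_apply (W : UnitaryRep G H) (f : CompactlySupportedContinuousMap G ℂ) (ξ : H) :
    W.integrated f ξ = ∫ g, f g • (W.U g : H →L[ℂ] H) ξ ∂(haar : Measure G) := rfl

lemma norm_integrated_le (W : UnitaryRep G H) (f : CompactlySupportedContinuousMap G ℂ) :
    ‖W.integrated f‖ ≤ ∫ g, ‖f g‖ ∂(haar : Measure G) :=
  LinearMap.mkContinuous_norm_le _ (integral_nonneg fun _ => norm_nonneg _) _

end UnitaryRep

/-- The family `(∫ f(g) U_g dg)_U` over all unitary representations `U` of `G`. -/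
def universalIntegrated (f : CompactlySupportedContinuousMap G ℂ) : BddFamilies G :=
  BddFamilies.mk G (fun i => i.rep.integrated f) (∫ g, ‖f g‖ ∂(haar : Measure G)) fun i =>
    i.rep.norm_integrated_le f

variable (G) in
/-- The full group C*-algebra `C*(G)`: the norm-closed *-algebra generated by `C_c(G)` (acting by
integration) in the product of all strongly continuous unitary representations of `G`; so
`‖f‖ = sup_U ‖∫ f(g) U_g dg‖` for `f ∈ C_c(G)`. -/
def groupCStarSubalgebra : NonUnitalStarSubalgebra ℂ (BddFamilies G) :=
  (NonUnitalStarAlgebra.adjoin ℂ (Set.range (universalIntegrated (G := G)))).topologicalClosure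

instance : IsClosed (groupCStarSubalgebra G : Set (BddFamilies G)) :=
  NonUnitalStarSubalgebra.isClosed_topologicalClosure _

variable (G) in
/-- The full group C*-algebra `C*(G)` as a type. -/
def GroupCStar : Type (u + 1) := groupCStarSubalgebra G

instance : NonUnitalCStarAlgebra (GroupCStar G) :=
  inferInstanceAs (NonUnitalCStarAlgebra (groupCStarSubalgebra G))

variable (G) in
/-- The inclusion of `C*(G)` into the product of all unitary representations of `G`. -/
def GroupCStar.incl : GroupCStar G →⋆ₙₐ[ℂ] BddFamilies G where
  toFun x := x.1
  map_smul' _ _ := rfl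
  map_zero' := rfl
  map_add' _ _ := rfl
  map_mul' _ _ := rfl
  map_star' _ := rfl

lemma GroupCStar.norm_incl (x : GroupCStar G) : ‖GroupCStar.incl G x‖ = ‖x‖ := rfl

/-- The image of `f ∈ C_c(G)` in `C*(G)`. -/
def GroupCStar.of (f : CompactlySupportedContinuousMap G ℂ) : GroupCStar G :=
  ⟨universalIntegrated f, NonUnitalStarSubalgebra.le_topologicalClosure _
    (NonUnitalStarAlgebra.subset_adjoin ℂ _ ⟨f, rfl⟩)⟩

/-- The representation `U_L` of `C*(G)` associated with a unitary representation `U` of `G`. It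
sends `f ∈ C_c(G)` to `∫ f(g) U_g dg`. -/
def UnitaryRep.cstarRep {H : Type u} [NormedAddCommGroup H] [InnerProductSpace ℂ H]
    [CompleteSpace H] (W : UnitaryRep G H) : GroupCStar G →⋆ₙₐ[ℂ] (H →L[ℂ] H) :=
  (BddFamilies.proj G ⟨H, W⟩).comp (GroupCStar.incl G)

lemma UnitaryRep.cstarRep_of {H : Type u} [NormedAddCommGroup H] [InnerProductSpace ℂ H]
    [CompleteSpace H] (W : UnitaryRep G H) (f : CompactlySupportedContinuousMap G ℂ) :
    W.cstarRep (GroupCStar.of f) = W.integrated f := rfl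

/-! ### The canonical map `η : G → M(C*(G))` -/

/-- The family `(U_g)_U` over all unitary representations `U` of `G`. -/
def universalUnitary (g : G) : BddFamilies G :=
  BddFamilies.mk G (fun i => (i.rep.U g : i.H →L[ℂ] i.H)) 1 fun i =>
    ContinuousLinearMap.opNorm_le_bound _ zero_le_one fun ξ => by
      rw [norm_unitary_apply, one_mul]

lemma star_universalUnitary (g : G) : star (universalUnitary g) = universalUnitary g⁻¹ := by
  refine BddFamilies.ext fun i => ?_
  change star (i.rep.U g : i.H →L[ℂ] i.H) = (i.rep.U g⁻¹ : i.H →L[ℂ] i.H)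
  rw [map_inv]
  rfl

lemma universalUnitary_mul_integrated (g : G) (f : CompactlySupportedContinuousMap G ℂ) :
    ∃ f' : CompactlySupportedContinuousMap G ℂ,
      universalUnitary g * universalIntegrated f = universalIntegrated f' := by
  refine ⟨⟨⟨fun h => f (g⁻¹ * h), by fun_prop⟩,
    f.hasCompactSupport.comp_homeomorph (Homeomorph.mulLeft g⁻¹)⟩, ?_⟩
  refine BddFamilies.ext fun i => ContinuousLinearMap.ext fun ξ => ?_
  change (i.rep.U g : i.H →L[ℂ] i.H) (∫ h, f h • (i.rep.U h : i.H →L[ℂ] i.H) ξ ∂haar) =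
    ∫ h, f (g⁻¹ * h) • (i.rep.U h : i.H →L[ℂ] i.H) ξ ∂haar
  rw [← ContinuousLinearMap.integral_comp_comm _ (i.rep.integrable_smul f ξ),
    ← integral_mul_left_eq_self (fun h => f (g⁻¹ * h) • (i.rep.U h : i.H →L[ℂ] i.H) ξ) g]
  refine integral_congr_ae (.of_forall fun h => ?_)
  simp [map_mul]

lemma integrated_mul_universalUnitary (g : G) (f : CompactlySupportedContinuousMap G ℂ) :
    ∃ f' : CompactlySupportedContinuousMap G ℂ,
      universalIntegrated f * universalUnitary g = universalIntegrated f' := by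
  have hreg : (Measure.map (· * g) (haar : Measure G)).Regular :=
    Regular.map (Homeomorph.mulRight g)
  have key := isMulLeftInvariant_eq_smul_of_regular (Measure.map (· * g) (haar : Measure G)) haar
  set c := haarScalarFactor (Measure.map (· * g) (haar : Measure G)) haar
  refine ⟨⟨⟨fun h => (c : ℂ) * f (h * g⁻¹), by fun_prop⟩,
    (f.hasCompactSupport.comp_homeomorph (Homeomorph.mulRight g⁻¹)).mul_left⟩, ?_⟩
  refine BddFamilies.ext fun i => ContinuousLinearMap.ext fun ξ => ?_
  change ∫ h, f h • (i.rep.U h : i.H →L[ℂ] i.H) ((i.rep.U g : i.H →L[ℂ] i.H) ξ) ∂haar =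
    ∫ h, ((c : ℂ) * f (h * g⁻¹)) • (i.rep.U h : i.H →L[ℂ] i.H) ξ ∂haar
  have h1 : ∫ h, f (h * g⁻¹) • (i.rep.U h : i.H →L[ℂ] i.H) ξ
      ∂(Measure.map (· * g) (haar : Measure G)) =
      ∫ h, f h • (i.rep.U h : i.H →L[ℂ] i.H) ((i.rep.U g : i.H →L[ℂ] i.H) ξ) ∂haar := by
    refine ((Homeomorph.mulRight g).measurableEmbedding.integral_map _).trans ?_
    refine integral_congr_ae (.of_forall fun h => ?_)
    simp [map_mul]
  rw [← h1, key, integral_smul_nnreal_measure]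
  simp only [mul_smul]
  rw [integral_smul]
  rfl

lemma mul_mem_groupCStar (x : BddFamilies G) (hx : x ∈ groupCStarSubalgebra G) :
    ∀ g : G, universalUnitary g * x ∈ groupCStarSubalgebra G ∧
      x * universalUnitary g ∈ groupCStarSubalgebra G := by
  have hcl : IsClosed (groupCStarSubalgebra G : Set (BddFamilies G)) :=
    NonUnitalStarSubalgebra.isClosed_topologicalClosure _
  have hof : ∀ f : CompactlySupportedContinuousMap G ℂ,
      universalIntegrated f ∈ groupCStarSubalgebra G := fun f => (GroupCStar.of f).2
  have hle : ∀ y, y ∈ NonUnitalStarAlgebra.adjoin ℂ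
      (Set.range (universalIntegrated (G := G))) → y ∈ groupCStarSubalgebra G := fun y hy =>
    NonUnitalStarSubalgebra.le_topologicalClosure _ hy
  have hadj : ∀ y, y ∈ NonUnitalStarAlgebra.adjoin ℂ (Set.range (universalIntegrated (G := G))) →
      ∀ g : G, universalUnitary g * y ∈ groupCStarSubalgebra G ∧
      y * universalUnitary g ∈ groupCStarSubalgebra G := by
    intro y hy
    induction hy using NonUnitalStarAlgebra.adjoin_induction with
    | mem y hy =>
      obtain ⟨f, rfl⟩ := hy
      intro g
      obtain ⟨f₁, h₁⟩ := universalUnitary_mul_integrated g f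
      obtain ⟨f₂, h₂⟩ := integrated_mul_universalUnitary g f
      rw [h₁, h₂]
      exact ⟨hof f₁, hof f₂⟩
    | add y z _ _ hy hz =>
      intro g
      rw [mul_add, add_mul]
      exact ⟨add_mem (hy g).1 (hz g).1, add_mem (hy g).2 (hz g).2⟩
    | zero =>
      intro g
      rw [mul_zero, zero_mul]
      exact ⟨zero_mem _, zero_mem _⟩
    | mul y z hy' hz' hy hz =>
      intro g
      rw [← mul_assoc, mul_assoc y]
      exact ⟨mul_mem (hy g).1 (hle z hz'), mul_mem (hle y hy') (hz g).2⟩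
    | smul r y _ hy =>
      intro g
      rw [mul_smul_comm, smul_mul_assoc]
      exact ⟨SMulMemClass.smul_mem r (hy g).1, SMulMemClass.smul_mem r (hy g).2⟩
    | star y _ hy =>
      intro g
      have e : universalUnitary g = star (universalUnitary g⁻¹) := by
        rw [star_universalUnitary, inv_inv]
      rw [e, ← star_mul, ← star_mul]
      exact ⟨star_mem (hy g⁻¹).2, star_mem (hy g⁻¹).1⟩
  intro g
  refine ⟨?_, ?_⟩
  · exact closure_minimal (t := {y | universalUnitary g * y ∈ groupCStarSubalgebra G})
      (fun y hy => (hadj y hy g).1) (hcl.preimage (continuous_const_mul _)) hx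
  · exact closure_minimal (t := {y | y * universalUnitary g ∈ groupCStarSubalgebra G})
      (fun y hy => (hadj y hy g).2) (hcl.preimage (continuous_mul_const _)) hx

/-- The canonical map `η : G → M(C*(G))`: the multiplier `η(g)` acts on `C*(G)` by multiplication
with `(U_g)_U`, so `η(g) f = f(g⁻¹ ·)` for `f ∈ C_c(G)`. -/
def GroupCStar.eta (g : G) : 𝓜(ℂ, GroupCStar G) where
  fst := LinearMap.mkContinuous
    { toFun := fun x => (⟨universalUnitary g * x.1, (mul_mem_groupCStar x.1 x.2 g).1⟩ :
        groupCStarSubalgebra G)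
      map_add' := fun x y => Subtype.ext (mul_add (universalUnitary g) x.1 y.1)
      map_smul' := fun c x => Subtype.ext (mul_smul_comm c (universalUnitary g) x.1) }
    ‖universalUnitary g‖ fun x => norm_mul_le (universalUnitary g) x.1
  snd := LinearMap.mkContinuous
    { toFun := fun x => (⟨x.1 * universalUnitary g, (mul_mem_groupCStar x.1 x.2 g).2⟩ :
        groupCStarSubalgebra G)
      map_add' := fun x y => Subtype.ext (add_mul x.1 y.1 (universalUnitary g))
      map_smul' := fun c x => Subtype.ext (smul_mul_assoc c x.1 (universalUnitary g)) }
    ‖universalUnitary g‖ fun x => (norm_mul_le x.1 (universalUnitary g)).trans_eq (mul_comm _ _)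
  central := fun x y => Subtype.ext (mul_assoc x.1 (universalUnitary g) y.1)

/-! ### The left regular representation on `L²(G, H)` -/

variable (G) in
/-- `L²(G, H)` with respect to left Haar measure. -/
abbrev L2 (H : Type u) [NormedAddCommGroup H] : Type u := Lp H 2 (haar : Measure G)

/-- Left translation `(λ_h ξ)(g) = ξ(h⁻¹ g)` as an isometry of `L²(G, H)`. -/
def leftTranslation (H : Type u) [NormedAddCommGroup H] [InnerProductSpace ℂ H] :
    G →* (L2 G H ≃ₗᵢ[ℂ] L2 G H) where
  toFun h :=
    { toFun := fun ξ => DomMulAct.mk h⁻¹ • ξ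
      invFun := fun ξ => DomMulAct.mk h • ξ
      left_inv := fun ξ => by simp [← mul_smul]
      right_inv := fun ξ => by simp [← mul_smul]
      map_add' := fun ξ ζ => smul_add _ ξ ζ
      map_smul' := fun c ξ => smul_comm _ c ξ
      norm_map' := fun ξ => DomMulAct.norm_smul_Lp _ ξ }
  map_one' := by
    ext1 ξ
    change DomMulAct.mk (1 : G)⁻¹ • ξ = ξ
    simp
  map_mul' h k := by
    ext1 ξ
    change DomMulAct.mk (h * k)⁻¹ • ξ = DomMulAct.mk h⁻¹ • (DomMulAct.mk k⁻¹ • ξ)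
    rw [← mul_smul, ← DomMulAct.mk_mul, mul_inv_rev]

lemma leftTranslation_ae_eq {H : Type u} [NormedAddCommGroup H] [InnerProductSpace ℂ H] (h : G)
    (ξ : L2 G H) : leftTranslation H h ξ =ᵐ[haar] fun g => ξ (h⁻¹ * g) :=
  DomMulAct.smul_Lp_ae_eq (DomMulAct.mk h⁻¹) ξ

/-- The left regular representation `λ` of `G` on `L²(G, H)`. -/
def leftRegular (H : Type u) [NormedAddCommGroup H] [InnerProductSpace ℂ H] [CompleteSpace H] :
    UnitaryRep G (L2 G H) where
  U := (Unitary.linearIsometryEquiv (𝕜 := ℂ) (H := L2 G H)).symm.toMonoidHom.comp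
    (leftTranslation H)
  strong_continuous ξ := by
    have : Fact ((2 : ℝ≥0∞) ≠ ∞) := ⟨by simp⟩
    have : Continuous fun g : G => DomMulAct.mk g⁻¹ • ξ :=
      (DomMulAct.continuous_mk.comp continuous_inv).smul continuous_const
    exact this

lemma leftRegular_apply {H : Type u} [NormedAddCommGroup H] [InnerProductSpace ℂ H]
    [CompleteSpace H] (h : G) (ξ : L2 G H) :
    ((leftRegular H).U h : L2 G H →L[ℂ] L2 G H) ξ = leftTranslation H h ξ := rfl

end Group

/-! ### The universal representation of a C*-algebra -/

section Algebra

variable (A : Type u) [NonUnitalCStarAlgebra A]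

variable {A} in
/-- The direct sum of a family of representations. -/
def directSumRep {ι : Type u} {K : ι → Type u} [∀ i, NormedAddCommGroup (K i)]
    [∀ i, InnerProductSpace ℂ (K i)] [∀ i, CompleteSpace (K i)]
    (ρ : ∀ i, A →⋆ₙₐ[ℂ] (K i →L[ℂ] K i)) : A →⋆ₙₐ[ℂ] (lp K 2 →L[ℂ] lp K 2) where
  toFun a := lp.mapCLM 2 (fun i => ρ i a) (norm_nonneg a) fun i =>
    NonUnitalStarAlgHom.norm_apply_le (ρ i) a
  map_smul' c a := by
    ext ξ i
    change ρ i (c • a) (ξ i) = c • ρ i a (ξ i)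
    simp
  map_zero' := by
    ext ξ i
    change ρ i 0 (ξ i) = 0
    simp
  map_add' a b := by
    ext ξ i
    change ρ i (a + b) (ξ i) = ρ i a (ξ i) + ρ i b (ξ i)
    simp
  map_mul' a b := by
    ext ξ i
    change ρ i (a * b) (ξ i) = ρ i a (ρ i b (ξ i))
    simp
  map_star' a := by
    refine (ContinuousLinearMap.eq_adjoint_iff _ _).mpr fun ξ ζ => ?_
    rw [lp.inner_eq_tsum, lp.inner_eq_tsum]
    refine tsum_congr fun i => ?_
    change inner ℂ (ρ i (star a) (ξ i)) (ζ i) = inner ℂ (ξ i) (ρ i a (ζ i))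
    rw [map_star, ContinuousLinearMap.star_eq_adjoint, ContinuousLinearMap.adjoint_inner_left]

variable {A} in
lemma directSumRep_apply {ι : Type u} {K : ι → Type u} [∀ i, NormedAddCommGroup (K i)]
    [∀ i, InnerProductSpace ℂ (K i)] [∀ i, CompleteSpace (K i)]
    (ρ : ∀ i, A →⋆ₙₐ[ℂ] (K i →L[ℂ] K i)) (a : A) (ξ : lp K 2) (i : ι) :
    directSumRep ρ a ξ i = ρ i a (ξ i) := rfl

variable [PartialOrder A] [StarOrderedRing A]

/-- The states of `A`: positive linear functionals of norm one. -/
def State : Type u :=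
  {φ : A →ₚ[ℂ] ℂ // IsLUB ((fun a => ‖φ a‖) '' Metric.closedBall 0 1) 1}

/-- The Hilbert space `H_u` of the universal representation: the direct sum of the GNS spaces of
all states. -/
abbrev UniversalSpace : Type u := lp (fun φ : State A => φ.1.GNS) 2

/-- The universal representation `π_u` of `A`: the direct sum of the GNS representations of all
states. -/
def universalRep : A →⋆ₙₐ[ℂ] (UniversalSpace A →L[ℂ] UniversalSpace A) :=
  directSumRep fun φ : State A => φ.1.gnsNonUnitalStarAlgHom

end Algebra

/-! ### Covariant representations -/

section Action

variable {G : Type u} [Group G] [TopologicalSpace G] {A : Type u} [NonUnitalCStarAlgebra A]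

/-- A covariant representation `(π, U)` of the C*-action `(A, G, α)` on `H`. -/
structure CovariantRep (α : G →* (A ≃⋆ₐ[ℂ] A)) (H : Type u) [NormedAddCommGroup H]
    [InnerProductSpace ℂ H] [CompleteSpace H] extends UnitaryRep G H where
  /-- the representation of the algebra -/
  π : A →⋆ₙₐ[ℂ] (H →L[ℂ] H)
  covariant : ∀ (g : G) (a : A),
    (toUnitaryRep.U g : H →L[ℂ] H) * π a * star (toUnitaryRep.U g : H →L[ℂ] H) = π (α g a)

/-- A representation on `H` is non-degenerate if the vectors `π(a) ξ` span a dense subspace. -/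
def IsNondegenerate {H : Type u} [NormedAddCommGroup H] [InnerProductSpace ℂ H] [CompleteSpace H]
    (π : A →⋆ₙₐ[ℂ] (H →L[ℂ] H)) : Prop :=
  Dense (Submodule.span ℂ {η : H | ∃ (a : A) (ξ : H), η = π a ξ} : Set H)

variable [IsTopologicalGroup G] [LocallyCompactSpace G] [MeasurableSpace G] [BorelSpace G]

section Induced

variable {H : Type u} [NormedAddCommGroup H] [InnerProductSpace ℂ H] [CompleteSpace H]

lemma norm_induced_le (α : G →* (A ≃⋆ₐ[ℂ] A)) (π : A →⋆ₙₐ[ℂ] (H →L[ℂ] H)) (a : A) (g : G)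
    (v : H) : ‖π (α g⁻¹ a) v‖ ≤ ‖a‖ * ‖v‖ := by
  refine (ContinuousLinearMap.le_opNorm _ _).trans ?_
  gcongr
  refine (NonUnitalStarAlgHom.norm_apply_le π _).trans ?_
  exact (NonUnitalStarAlgHom.norm_apply_le (α g⁻¹ : A →⋆ₙₐ[ℂ] A) a)

/-- The vectors `ξ ∈ L²(G, H)` on which `π̃(a)` is defined, i.e. for which the function
`g ↦ π(α_{g⁻¹}(a)) ξ(g)` is (strongly) measurable. When `α` is continuous this is all of
`L²(G, H)`, but no continuity of `α` is assumed here. -/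
def inducedDomain (α : G →* (A ≃⋆ₐ[ℂ] A)) (π : A →⋆ₙₐ[ℂ] (H →L[ℂ] H)) (a : A) :
    Submodule ℂ (L2 G H) where
  carrier := {ξ | AEStronglyMeasurable (fun g => π (α g⁻¹ a) (ξ g)) (haar : Measure G)}
  zero_mem' := by
    refine (aestronglyMeasurable_zero (β := H)).congr ?_
    filter_upwards [Lp.coeFn_zero H 2 (haar : Measure G)] with g hg
    rw [hg, Pi.zero_apply, map_zero]
  add_mem' := fun {ξ ζ} hξ hζ => by
    refine (AEStronglyMeasurable.add hξ hζ).congr ?_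
    filter_upwards [Lp.coeFn_add ξ ζ] with g hg
    rw [hg, Pi.add_apply, Pi.add_apply, map_add]
  smul_mem' := fun c ξ hξ => by
    refine (AEStronglyMeasurable.const_smul hξ c).congr ?_
    filter_upwards [Lp.coeFn_smul c ξ] with g hg
    rw [hg, Pi.smul_apply, Pi.smul_apply, map_smul]

lemma memLp_induced {α : G →* (A ≃⋆ₐ[ℂ] A)} {π : A →⋆ₙₐ[ℂ] (H →L[ℂ] H)} {a : A}
    (ξ : inducedDomain (G := G) α π a) :
    MemLp (fun g => π (α g⁻¹ a) ((ξ : L2 G H) g)) 2 (haar : Measure G) :=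
  (Lp.memLp (ξ : L2 G H)).of_le_mul ξ.2
    (.of_forall fun g => norm_induced_le α π a g ((ξ : L2 G H) g))

/-- The operator `π̃(a)` on `L²(G, H)`, `(π̃(a) ξ)(g) = π(α_{g⁻¹}(a)) ξ(g)`. -/
def induced (α : G →* (A ≃⋆ₐ[ℂ] A)) (π : A →⋆ₙₐ[ℂ] (H →L[ℂ] H)) (a : A) :
    L2 G H →ₗ.[ℂ] L2 G H where
  domain := inducedDomain α π a
  toFun :=
    { toFun := fun ξ => (memLp_induced ξ).toLp _
      map_add' := fun ξ ζ => by
        rw [← MemLp.toLp_add, MemLp.toLp_eq_toLp_iff]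
        filter_upwards [Lp.coeFn_add (ξ : L2 G H) (ζ : L2 G H)] with g hg
        change π (α g⁻¹ a) (((ξ : L2 G H) + (ζ : L2 G H) : L2 G H) g) =
          π (α g⁻¹ a) ((ξ : L2 G H) g) + π (α g⁻¹ a) ((ζ : L2 G H) g)
        rw [hg, Pi.add_apply, map_add]
      map_smul' := fun c ξ => by
        rw [RingHom.id_apply, ← MemLp.toLp_const_smul, MemLp.toLp_eq_toLp_iff]
        filter_upwards [Lp.coeFn_smul c (ξ : L2 G H)] with g hg
        change π (α g⁻¹ a) ((c • (ξ : L2 G H) : L2 G H) g) = c • π (α g⁻¹ a) ((ξ : L2 G H) g)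
        rw [hg, Pi.smul_apply, map_smul] }

lemma induced_ae_eq (α : G →* (A ≃⋆ₐ[ℂ] A)) (π : A →⋆ₙₐ[ℂ] (H →L[ℂ] H)) (a : A)
    (ξ : (induced (G := G) α π a).domain) :
    induced α π a ξ =ᵐ[haar] fun g => π (α g⁻¹ a) ((ξ : L2 G H) g) :=
  MemLp.coeFn_toLp (memLp_induced ξ)

lemma norm_induced_apply_le (α : G →* (A ≃⋆ₐ[ℂ] A)) (π : A →⋆ₙₐ[ℂ] (H →L[ℂ] H)) (a : A)
    (ξ : (induced (G := G) α π a).domain) : ‖induced α π a ξ‖ ≤ ‖a‖ * ‖(ξ : L2 G H)‖ := by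
  refine Lp.norm_le_mul_norm_of_ae_le_mul ?_
  filter_upwards [induced_ae_eq α π a ξ] with g hg
  rw [hg]
  exact norm_induced_le α π a g _

/-- The operator norm of `T S` on its natural domain `{ξ | S ξ ∈ dom T}`. -/
def compNorm {E : Type u} [NormedAddCommGroup E] [NormedSpace ℂ E] (T : E →ₗ.[ℂ] E)
    (S : E →L[ℂ] E) : ℝ :=
  sSup {r : ℝ | ∃ (ξ : E) (h : S ξ ∈ T.domain), ‖ξ‖ ≤ 1 ∧ r = ‖T ⟨S ξ, h⟩‖}

/-- The supremum defining the norm of `π̃(a) S` is over a bounded set. -/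
lemma bddAbove_compNorm_induced (α : G →* (A ≃⋆ₐ[ℂ] A)) (π : A →⋆ₙₐ[ℂ] (H →L[ℂ] H)) (a : A)
    (S : L2 G H →L[ℂ] L2 G H) :
    BddAbove {r : ℝ | ∃ (ξ : L2 G H) (h : S ξ ∈ (induced α π a).domain),
      ‖ξ‖ ≤ 1 ∧ r = ‖induced α π a ⟨S ξ, h⟩‖} := by
  refine ⟨‖a‖ * ‖S‖, ?_⟩
  rintro _ ⟨ξ, h, hξ, rfl⟩
  refine (norm_induced_apply_le α π a ⟨S ξ, h⟩).trans ?_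
  gcongr
  exact S.unit_le_opNorm ξ hξ

/-- When `T` is an everywhere defined bounded operator, `compNorm` is the usual operator norm. -/
lemma compNorm_eq_norm {E : Type u} [NormedAddCommGroup E] [NormedSpace ℂ E]
    (T : E →ₗ.[ℂ] E) (T' S : E →L[ℂ] E) (hdom : T.domain = ⊤)
    (hT : ∀ ξ : T.domain, T ξ = T' ξ) : compNorm T S = ‖T' * S‖ := by
  rw [← ContinuousLinearMap.sSup_unitClosedBall_eq_norm, compNorm]
  congr 1
  ext r
  constructor
  · rintro ⟨ξ, h, hξ, rfl⟩
    exact ⟨ξ, by simpa using hξ, by rw [hT]; rfl⟩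
  · rintro ⟨ξ, hξ, rfl⟩
    exact ⟨ξ, by rw [hdom]; trivial, by simpa using hξ, by rw [hT]; rfl⟩

end Induced

/-! ### Crossed product hosts -/

/-- A crossed product host `(C, η_A, η_L)` for the C*-action `(A, G, α)` and the host algebra
`C*(G)`. -/
structure CrossedProductHost (α : G →* (A ≃⋆ₐ[ℂ] A)) (C : Type v) [NonUnitalCStarAlgebra C] where
  /-- the morphism `η_A` -/
  etaA : A →⋆ₙₐ[ℂ] 𝓜(ℂ, C)
  /-- the morphism `η_L` -/
  etaL : GroupCStar G →⋆ₙₐ[ℂ] 𝓜(ℂ, C)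
  /-- `η_L` is non-degenerate: `η_L(L) C` spans a dense subspace of `C`. -/
  nondegenerate : Dense (Submodule.span ℂ
    {c : C | ∃ (l : GroupCStar G) (c' : C), c = (etaL l).fst c'} : Set C)
  /-- The extension of `η_L` to the multiplier algebra implements the action. (As `η_L` is
  non-degenerate, there is exactly one `*`-homomorphism `E` extending it.) -/
  covariant : ∃ E : 𝓜(ℂ, GroupCStar G) →⋆ₐ[ℂ] 𝓜(ℂ, C),
    (∀ l : GroupCStar G, E (l : 𝓜(ℂ, GroupCStar G)) = etaL l) ∧
    ∀ (g : G) (a : A),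
      E (GroupCStar.eta g) * etaA a * star (E (GroupCStar.eta g)) = etaA (α g a)
  /-- `η_A(A) η_L(L) ⊆ C` -/
  mul_mem : ∀ (a : A) (l : GroupCStar G), ∃ c : C, (c : 𝓜(ℂ, C)) = etaA a * etaL l
  /-- `C` is generated by `η_A(A) η_L(L)` as a C*-algebra. -/
  generates : (NonUnitalStarAlgebra.adjoin ℂ
    {c : C | ∃ (a : A) (l : GroupCStar G), (c : 𝓜(ℂ, C)) = etaA a * etaL l}).topologicalClosure = ⊤

/-- A crossed product host is full if every covariant representation `(π, U)`, with `π`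
non-degenerate, comes from a unique representation `ρ` of `C` with
`ρ(η_A(a) η_L(l)) = π(a) U_L(l)`. -/
def CrossedProductHost.IsFull {α : G →* (A ≃⋆ₐ[ℂ] A)} {C : Type v} [NonUnitalCStarAlgebra C]
    (P : CrossedProductHost α C) : Prop :=
  ∀ (H : Type u) [NormedAddCommGroup H] [InnerProductSpace ℂ H] [CompleteSpace H]
    (W : CovariantRep α H), IsNondegenerate W.π →
    ∃! ρ : C →⋆ₙₐ[ℂ] (H →L[ℂ] H), ∀ (a : A) (l : GroupCStar G) (c : C),
      (c : 𝓜(ℂ, C)) = P.etaA a * P.etaL l → ρ c = W.π a * W.cstarRep l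

end Action

end CrossedHost

end

open CrossedHost

/-! The argument is Fell absorption combined with amenability. For `f ∈ C_c(G)` with `∫ f² = 1`, the
map sending `v` to `V_f v = (g ↦ f(g) U_{g⁻¹} v)` is an isometry `H → L²(G, H)`. Covariance says
`π(α_{g⁻¹}(a)) U_{g⁻¹} = U_{g⁻¹} π(a)`, so `π̃(a) V_f = V_f π(a)` exactly
(`CovariantRep.induced_twist`), while `λ_h V_f = V_{f(h⁻¹ ·)} U_h` (`UnitaryRep.leftRegular_twist`).
When `f` is almost invariant on large compact sets, `λ_L(l) V_f v` is close to `V_f U_L(l) v`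
(`exists_twist_net`), so `‖π(a) U_L(l) v‖ = ‖π̃(a) V_f U_L(l) v‖` is close to `‖π̃(a) λ_L(l) V_f
v‖`. Two points remain.

Passing from `π̃` to `π̃_u` (`CovariantRep.norm_induced_leftRegular_le`): `π̃(a)` is everywhere
defined, because `g ↦ U_{g⁻¹} π(a) U_g v` is continuous. The representation `π` need not embed in
`π_u`, but each of its cyclic pieces does, and an intertwiner `H → H_u` applied pointwise respects
domains and commutes with `λ`. By Pythagoras the bound survives finite orthogonal sums of cyclic
pieces (`exists_large_projection`); since simple functions take finitely many values, these sums
suffice (`norm_le_of_intertwiners`).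

Existence of `f`: it is the square root of a Reiter density. For finitely many translations such
densities come from an invariant mean by Hahn–Banach separation in the dual of `C_b(G)`
(`exists_finite_almost_invariant`); compact sets follow because left and right translations commute
(`exists_almost_invariant`). -/

noncomputable section

namespace CrossedHost

/-! ### Cyclic subrepresentations inside the universal representation -/

section GNS

variable {A : Type u} [NonUnitalCStarAlgebra A]
variable {H : Type u} [NormedAddCommGroup H] [InnerProductSpace ℂ H] [CompleteSpace H]

lemma inner_rep_star_mul (π : A →⋆ₙₐ[ℂ] (H →L[ℂ] H)) (a b : A) (v w : H) :
    inner ℂ v (π (star a * b) w) = inner ℂ (π a v) (π b w) := by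
  rw [map_mul, map_star, mul_apply_eq_comp, ContinuousLinearMap.star_eq_adjoint,
    ContinuousLinearMap.adjoint_inner_right]

variable [PartialOrder A] [StarOrderedRing A]

/-- The positive functional `a ↦ ⟪v, π(a) v⟫`. -/
def vectorFunctional (π : A →⋆ₙₐ[ℂ] (H →L[ℂ] H)) (v : H) : A →ₚ[ℂ] ℂ :=
  PositiveLinearMap.mk₀
    { toFun := fun a => inner ℂ v (π a v)
      map_add' := fun a b => by simp
      map_smul' := fun c a => by simp }
    fun a ha => by
      obtain ⟨b, rfl⟩ := CStarAlgebra.nonneg_iff_eq_star_mul_self.mp ha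
      change 0 ≤ inner ℂ v (π (star b * b) v)
      rw [inner_rep_star_mul, inner_self_eq_norm_sq_to_K, ← RCLike.ofReal_pow]
      exact RCLike.ofReal_nonneg.mpr (sq_nonneg ‖π b v‖)

lemma vectorFunctional_apply (π : A →⋆ₙₐ[ℂ] (H →L[ℂ] H)) (v : H) (a : A) :
    vectorFunctional π v a = inner ℂ v (π a v) := rfl

lemma vectorFunctional_smul (π : A →⋆ₙₐ[ℂ] (H →L[ℂ] H)) (v : H) (r : ℝ) (a : A) :
    vectorFunctional π ((r : ℂ) • v) a = (r : ℂ) ^ 2 * vectorFunctional π v a := by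
  simp only [vectorFunctional_apply, map_smul, inner_smul_left, inner_smul_right, Complex.conj_ofReal]
  ring

/-- A vector not annihilated by `π` has a multiple whose vector functional is a state. -/
lemma exists_isLUB_vectorFunctional (π : A →⋆ₙₐ[ℂ] (H →L[ℂ] H)) (v : H)
    (hv : ∃ b, π b v ≠ 0) : ∃ r : ℝ, r ≠ 0 ∧
    IsLUB ((fun a => ‖vectorFunctional π ((r : ℂ) • v) a‖) '' Metric.closedBall 0 1) 1 := by
  obtain ⟨b, hb⟩ := hv
  let L : A →L[ℂ] ℂ := LinearMap.mkContinuous (vectorFunctional π v : A →ₗ[ℂ] ℂ) (‖v‖ * ‖v‖)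
    fun a => by
      refine (norm_inner_le_norm v (π a v)).trans ?_
      have h1 := (π a).le_opNorm v
      have h2 := NonUnitalStarAlgHom.norm_apply_le π a
      calc ‖v‖ * ‖π a v‖ ≤ ‖v‖ * (‖a‖ * ‖v‖) := by gcongr; exact h1.trans (by gcongr)
        _ = _ := by ring
  have hL : ∀ a, L a = vectorFunctional π v a := fun a => rfl
  have hL0 : 0 < ‖L‖ := by
    rw [norm_pos_iff]
    intro h
    have h1 : inner ℂ v (π (star b * b) v) = 0 := by
      rw [← vectorFunctional_apply, ← hL, h]; rfl
    rw [inner_rep_star_mul, inner_self_eq_zero] at h1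
    exact hb h1
  have hlub : IsLUB ((fun a => ‖L a‖) '' Metric.closedBall 0 1) ‖L‖ := by
    rw [← ContinuousLinearMap.sSup_unitClosedBall_eq_norm]
    refine isLUB_csSup ⟨_, 0, by simp, rfl⟩ ⟨‖L‖, ?_⟩
    rintro _ ⟨a, ha, rfl⟩
    exact L.unit_le_opNorm a (by simpa using ha)
  -- The vector functional is quadratic in the vector, so this scaling divides its norm by `‖L‖`.
  refine ⟨(√‖L‖)⁻¹, by positivity, ?_⟩
  have key : ∀ a, ‖vectorFunctional π ((((√‖L‖)⁻¹ : ℝ) : ℂ) • v) a‖ = ‖L‖⁻¹ * ‖L a‖ := by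
    intro a
    rw [vectorFunctional_smul, ← hL, norm_mul, norm_pow, Complex.norm_real, norm_inv, inv_pow,
      Real.norm_of_nonneg (Real.sqrt_nonneg _), Real.sq_sqrt hL0.le]
  simp only [key]
  refine ⟨?_, fun M hM => ?_⟩
  · rintro _ ⟨a, ha, rfl⟩
    have := hlub.1 ⟨a, ha, rfl⟩
    rw [inv_mul_le_iff₀ hL0, mul_one]
    exact this
  · have : ‖L‖ ≤ ‖L‖ * M := hlub.2 (by
      rintro _ ⟨a, ha, rfl⟩
      have := hM ⟨a, ha, rfl⟩
      simpa [inv_mul_le_iff₀ hL0] using this)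
    nlinarith

/-- The isometry of the GNS space of a vector functional into the original space. -/
lemma exists_gns_isometry (π : A →⋆ₙₐ[ℂ] (H →L[ℂ] H)) (v : H) :
    ∃ S : (vectorFunctional π v).GNS →ₗᵢ[ℂ] H,
      (∀ a x, S ((vectorFunctional π v).gnsNonUnitalStarAlgHom a x) = π a (S x)) ∧
      ∀ a : A, S (((vectorFunctional π v).toPreGNS a : (vectorFunctional π v).PreGNS) :
        (vectorFunctional π v).GNS) = π a v := by
  set φ := vectorFunctional π v with hφ
  -- Isometric since `‖π(x) v‖² = φ(x* x)`; it then extends to the completion.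
  let S₀ : φ.PreGNS →ₗᵢ[ℂ] H :=
    { toFun := fun x => π (φ.ofPreGNS x) v
      map_add' := fun x y => by simp
      map_smul' := fun c x => by simp
      norm_map' := fun x => by
        change ‖π (φ.ofPreGNS x) v‖ = ‖x‖
        rw [← sq_eq_sq₀ (norm_nonneg _) (norm_nonneg _)]
        have := φ.preGNS_norm_sq x
        rw [hφ, vectorFunctional_apply, inner_rep_star_mul, inner_self_eq_norm_sq_to_K,
          RCLike.ofReal_eq_complex_ofReal] at this
        exact_mod_cast this.symm }
  let S₁ : φ.GNS →L[ℂ] H := S₀.toContinuousLinearMap.extend (UniformSpace.Completion.toComplL)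
  have hS₁ : ∀ x : φ.PreGNS, S₁ (x : φ.GNS) = S₀ x := fun x =>
    ContinuousLinearMap.extend_eq _ UniformSpace.Completion.denseRange_coe
      (UniformSpace.Completion.isUniformInducing_coe _) x
  refine ⟨⟨S₁.toLinearMap, fun x => ?_⟩, fun a x => ?_, fun a => hS₁ _⟩
  · change ‖S₁ x‖ = ‖x‖
    induction x using UniformSpace.Completion.induction_on with
    | hp => exact isClosed_eq (by fun_prop) (by fun_prop)
    | ih x => rw [hS₁, S₀.norm_map, UniformSpace.Completion.norm_coe]
  · change S₁ _ = π a (S₁ x)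
    induction x using UniformSpace.Completion.induction_on with
    | hp => exact isClosed_eq (by fun_prop) (by fun_prop)
    | ih x =>
      rw [PositiveLinearMap.gnsNonUnitalStarAlgHom_apply_coe, hS₁, hS₁]
      change π (a * φ.ofPreGNS x) v = π a (π (φ.ofPreGNS x) v)
      rw [map_mul]; rfl

/-- Each summand of a direct sum of representations is included isometrically and equivariantly. -/
lemma exists_directSumRep_inclusion {ι : Type u} {K : ι → Type u} [∀ i, NormedAddCommGroup (K i)]
    [∀ i, InnerProductSpace ℂ (K i)] [∀ i, CompleteSpace (K i)]
    (ρ : ∀ i, A →⋆ₙₐ[ℂ] (K i →L[ℂ] K i)) (i : ι) :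
    ∃ T : K i →L[ℂ] lp K 2, (∀ x, ‖T x‖ = ‖x‖) ∧
      ∀ a x, T (ρ i a x) = directSumRep ρ a (T x) := by
  classical
  refine ⟨lp.singleContinuousLinearMap ℂ K 2 i, fun x => ?_, fun a x => ?_⟩
  · rw [lp.singleContinuousLinearMap_apply, lp.norm_single (by simp)]
  · ext j
    rw [lp.singleContinuousLinearMap_apply, lp.singleContinuousLinearMap_apply, directSumRep_apply]
    by_cases h : j = i
    · subst h
      rw [lp.single_apply_self, lp.single_apply_self]
    · rw [lp.single_apply_ne _ _ _ h, lp.single_apply_ne _ _ _ h, map_zero]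

/-- The projection `P` onto the cyclic subspace generated by `v` is implemented by an intertwiner
into the universal representation. -/
lemma exists_universal_intertwiner (π : A →⋆ₙₐ[ℂ] (H →L[ℂ] H)) (v : H) :
    ∃ (J : H →L[ℂ] UniversalSpace A) (P : H →L[ℂ] H),
      (∀ b x, J (π b x) = universalRep A b (J x)) ∧
      IsStarProjection P ∧ (∀ b, Commute P (π b)) ∧ (∀ x, ‖J x‖ = ‖P x‖) ∧
      (∀ b, P (π b v) = π b v) ∧ ∀ Q : H →L[ℂ] H, (∀ b, Q (π b v) = 0) → Q * P = 0 := by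
  by_cases hv : ∃ b, π b v ≠ 0
  -- If `π(A) v = 0`, no multiple of `v` gives a state, but the cyclic subspace is zero and so are
  -- `J` and `P`.
  swap
  · push Not at hv
    exact ⟨0, 0, by simp, .zero _, fun b => .zero_left _, by simp, by simp [hv], by simp⟩
  obtain ⟨r, hr, hlub⟩ := exists_isLUB_vectorFunctional π v hv
  set w : H := (r : ℂ) • v with hw
  have hr' : (r : ℂ) ≠ 0 := by exact_mod_cast hr
  let ψ : State A := ⟨vectorFunctional π w, hlub⟩
  obtain ⟨S, hS, hS'⟩ := exists_gns_isometry π w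
  let T : ψ.1.GNS →L[ℂ] H := S.toContinuousLinearMap
  have hTT : ∀ x, T.adjoint (T x) = x := fun x => by
    refine ext_inner_left ℂ fun y => ?_
    rw [ContinuousLinearMap.adjoint_inner_right]
    exact S.inner_map_map y x
  have hTadj : ∀ b x, T.adjoint (π b x) = ψ.1.gnsNonUnitalStarAlgHom b (T.adjoint x) := by
    intro b x
    refine ext_inner_right ℂ fun y => ?_
    have h1 := ContinuousLinearMap.adjoint_inner_left (π (star b)) (T y) x
    have h2 := ContinuousLinearMap.adjoint_inner_left (ψ.1.gnsNonUnitalStarAlgHom (star b)) y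
      (T.adjoint x)
    rw [← ContinuousLinearMap.star_eq_adjoint, ← map_star, star_star] at h1 h2
    rw [h2, ContinuousLinearMap.adjoint_inner_left, ContinuousLinearMap.adjoint_inner_left, h1]
    congr 1
    exact (hS (star b) y).symm
  have hcom : ∀ b x, (T ∘L T.adjoint) (π b x) = π b ((T ∘L T.adjoint) x) := fun b x => by
    change T (T.adjoint (π b x)) = π b (T (T.adjoint x))
    rw [hTadj]; exact hS b _
  obtain ⟨V, hV, hV'⟩ := exists_directSumRep_inclusion
    (fun φ : State A => φ.1.gnsNonUnitalStarAlgHom) ψ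
  -- `T T*` is the projection onto the range of the isometry `T`, that is, onto the closure of `π(A)
  -- v`. As `V` and `T` are isometric, `‖V T* x‖ = ‖T* x‖ = ‖T T* x‖`.
  refine ⟨V ∘L T.adjoint,
    T ∘L T.adjoint, fun b x => ?_, ⟨?_, ?_⟩, fun b => ?_, fun x => ?_, fun b => ?_,
    fun Q hQ => ?_⟩
  · change V (T.adjoint (π b x)) = _
    rw [hTadj]
    exact hV' b _
  · ext x
    exact congrArg T (hTT _)
  · rw [ContinuousLinearMap.isSelfAdjoint_iff', ContinuousLinearMap.adjoint_comp,
      ContinuousLinearMap.adjoint_adjoint]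
  · ext x
    exact hcom b x
  · exact (hV _).trans (S.norm_map _).symm
  · have h1 : (T ∘L T.adjoint) (π b w) = π b w := by
      have : T ((ψ.1.toPreGNS b : ψ.1.PreGNS) : ψ.1.GNS) = π b w := hS' b
      rw [← this]
      exact congrArg T (hTT _)
    rw [hw, map_smul, map_smul] at h1
    exact smul_right_injective H hr' h1
  · ext x
    change Q (T (T.adjoint x)) = 0
    generalize T.adjoint x = y
    induction y using UniformSpace.Completion.induction_on with
    | hp => exact isClosed_eq (by fun_prop) (by fun_prop)
    | ih y =>
      have : T (y : ψ.1.GNS) = π (ψ.1.ofPreGNS y) w := hS' (ψ.1.ofPreGNS y)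
      rw [this, hw, map_smul, map_smul, hQ, smul_zero]

end GNS

/-! ### Intertwiners on `L²(G, H)` and domains of induced operators -/

section L2

variable {G : Type u} [Group G] [TopologicalSpace G] [IsTopologicalGroup G] [LocallyCompactSpace G]
  [MeasurableSpace G] [BorelSpace G]

/-- A closed property of bounded families that is inherited by sums, products, multiples and
adjoints and holds for `C_c(G)` holds on `C*(G)`. -/
lemma GroupCStar.incl_induction {p : BddFamilies G → Prop} (hcl : IsClosed {x | p x})
    (hzero : p 0) (hadd : ∀ x y, p x → p y → p (x + y)) (hmul : ∀ x y, p x → p y → p (x * y))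
    (hsmul : ∀ (c : ℂ) x, p x → p (c • x)) (hstar : ∀ x, p x → p (star x))
    (hof : ∀ f, p (universalIntegrated f)) (l : GroupCStar G) : p (GroupCStar.incl G l) := by
  refine closure_minimal (t := {x | p x}) (fun y hy => ?_) hcl l.2
  change p y
  induction hy using NonUnitalStarAlgebra.adjoin_induction with
  | mem y hy => obtain ⟨f, rfl⟩ := hy; exact hof f
  | add y z _ _ hy hz => exact hadd y z hy hz
  | zero => exact hzero
  | mul y z _ _ hy hz => exact hmul y z hy hz
  | smul r y _ hy => exact hsmul r y hy
  | star y _ hy => exact hstar y hy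

lemma BddFamilies.norm_proj_le (i : BundledRep G) (x : BddFamilies G) :
    ‖BddFamilies.proj G i x‖ ≤ ‖x‖ :=
  lp.norm_apply_le_norm ENNReal.top_ne_zero x i

lemma BddFamilies.continuous_proj (i : BundledRep G) : Continuous (BddFamilies.proj G i) :=
  AddMonoidHomClass.continuous_of_bound (BddFamilies.proj G i) 1 fun x => by
    rw [one_mul]; exact BddFamilies.norm_proj_le i x

variable {H K : Type u} [NormedAddCommGroup H] [InnerProductSpace ℂ H] [CompleteSpace H]
  [NormedAddCommGroup K] [InnerProductSpace ℂ K] [CompleteSpace K]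

lemma UnitaryRep.star_apply (W : UnitaryRep G H) (g : G) :
    star (W.U g : H →L[ℂ] H) = (W.U g⁻¹ : H →L[ℂ] H) := by
  rw [map_inv]; rfl

lemma UnitaryRep.inv_apply_apply (W : UnitaryRep G H) (g : G) (x : H) :
    (W.U g⁻¹ : H →L[ℂ] H) ((W.U g : H →L[ℂ] H) x) = x := by
  have : (W.U g⁻¹ : H →L[ℂ] H) * (W.U g : H →L[ℂ] H) = 1 := by
    rw [← Submonoid.coe_mul, ← map_mul, inv_mul_cancel, map_one]; rfl
  exact congrArg (fun T : H →L[ℂ] H => T x) this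

lemma integrated_intertwine (U : UnitaryRep G H) (W : UnitaryRep G K) (V : H →L[ℂ] K)
    (hV : ∀ g x, V ((U.U g : H →L[ℂ] H) x) = (W.U g : K →L[ℂ] K) (V x))
    (f : CompactlySupportedContinuousMap G ℂ) (x : H) :
    V (U.integrated f x) = W.integrated f (V x) := by
  rw [UnitaryRep.integrated_apply, UnitaryRep.integrated_apply,
    ← ContinuousLinearMap.integral_comp_comm _ (U.integrable_smul f x)]
  simp only [map_smul, hV]

/-- The families intertwined by `V` alone need not be closed under adjoints. Requiring the relation
for both `V` and its adjoint repairs this, since taking adjoints exchanges the two relations. -/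
lemma cstarRep_intertwine (U : UnitaryRep G H) (W : UnitaryRep G K) (V : H →L[ℂ] K)
    (hV : ∀ g x, V ((U.U g : H →L[ℂ] H) x) = (W.U g : K →L[ℂ] K) (V x))
    (l : GroupCStar G) (x : H) : V (U.cstarRep l x) = W.cstarRep l (V x) := by
  have hV' : ∀ g y, V.adjoint ((W.U g : K →L[ℂ] K) y) = (U.U g : H →L[ℂ] H) (V.adjoint y) := by
    intro g y
    refine ext_inner_right ℂ fun z => ?_
    have h1 := ContinuousLinearMap.adjoint_inner_left (W.U g⁻¹ : K →L[ℂ] K) (V z) y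
    have h2 := ContinuousLinearMap.adjoint_inner_left (U.U g⁻¹ : H →L[ℂ] H) z (V.adjoint y)
    rw [← ContinuousLinearMap.star_eq_adjoint, UnitaryRep.star_apply, inv_inv] at h1 h2
    rw [h2, ContinuousLinearMap.adjoint_inner_left, ContinuousLinearMap.adjoint_inner_left, h1, hV]
  let i : BundledRep G := ⟨H, U⟩
  let j : BundledRep G := ⟨K, W⟩
  let P : BddFamilies G → H →L[ℂ] H := BddFamilies.proj G i
  let Q : BddFamilies G → K →L[ℂ] K := BddFamilies.proj G j
  have hPc : Continuous P := BddFamilies.continuous_proj i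
  have hQc : Continuous Q := BddFamilies.continuous_proj j
  have key : V ∘L P (GroupCStar.incl G l) = Q (GroupCStar.incl G l) ∘L V ∧
      V.adjoint ∘L Q (GroupCStar.incl G l) = P (GroupCStar.incl G l) ∘L V.adjoint := by
    refine GroupCStar.incl_induction
      (p := fun x => V ∘L P x = Q x ∘L V ∧ V.adjoint ∘L Q x = P x ∘L V.adjoint)
      ?_ ?_ ?_ ?_ ?_ ?_ ?_ l
    · exact (isClosed_eq (by fun_prop) (by fun_prop)).inter
        (isClosed_eq (by fun_prop) (by fun_prop))
    · have hP : P 0 = 0 := map_zero (BddFamilies.proj G i)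
      have hQ : Q 0 = 0 := map_zero (BddFamilies.proj G j)
      rw [hP, hQ]; simp
    · rintro x y ⟨hx, hx'⟩ ⟨hy, hy'⟩
      have hP : P (x + y) = P x + P y := map_add (BddFamilies.proj G i) x y
      have hQ : Q (x + y) = Q x + Q y := map_add (BddFamilies.proj G j) x y
      rw [hP, hQ]
      simp only [ContinuousLinearMap.comp_add, ContinuousLinearMap.add_comp, hx, hx', hy, hy',
        and_self]
    · rintro x y ⟨hx, hx'⟩ ⟨hy, hy'⟩
      have hP : P (x * y) = P x ∘L P y := map_mul (BddFamilies.proj G i) x y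
      have hQ : Q (x * y) = Q x ∘L Q y := map_mul (BddFamilies.proj G j) x y
      rw [hP, hQ]
      constructor
      · rw [← ContinuousLinearMap.comp_assoc, hx, ContinuousLinearMap.comp_assoc, hy,
          ContinuousLinearMap.comp_assoc]
      · rw [← ContinuousLinearMap.comp_assoc, hx', ContinuousLinearMap.comp_assoc, hy',
          ContinuousLinearMap.comp_assoc]
    · rintro c x ⟨hx, hx'⟩
      have hP : P (c • x) = c • P x := map_smul (BddFamilies.proj G i) c x
      have hQ : Q (c • x) = c • Q x := map_smul (BddFamilies.proj G j) c x
      rw [hP, hQ]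
      simp only [ContinuousLinearMap.comp_smul, ContinuousLinearMap.smul_comp, hx, hx', and_self]
    · rintro x ⟨hx, hx'⟩
      have hP : P (star x) = (P x).adjoint := map_star (BddFamilies.proj G i) x
      have hQ : Q (star x) = (Q x).adjoint := map_star (BddFamilies.proj G j) x
      rw [hP, hQ]
      constructor
      · have := congrArg ContinuousLinearMap.adjoint hx'
        simpa only [ContinuousLinearMap.adjoint_comp, ContinuousLinearMap.adjoint_adjoint]
          using this.symm
      · have := congrArg ContinuousLinearMap.adjoint hx
        simpa only [ContinuousLinearMap.adjoint_comp, ContinuousLinearMap.adjoint_adjoint]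
          using this.symm
    · intro f
      constructor
      · ext y
        exact integrated_intertwine U W V hV f y
      · ext y
        exact integrated_intertwine W U V.adjoint hV' f y
  exact congrArg (fun T : H →L[ℂ] K => T x) key.1

/-- Pointwise application of an operator commutes with left translation. -/
lemma compLpL_leftTranslation (V : H →L[ℂ] K) (h : G) (ξ : L2 G H) :
    V.compLpL 2 (haar : Measure G) (leftTranslation H h ξ) =
      leftTranslation K h (V.compLpL 2 haar ξ) := by
  refine Lp.ext ?_
  have hq : QuasiMeasurePreserving (fun g : G => h⁻¹ * g) haar haar :=
    (measurePreserving_mul_left haar h⁻¹).quasiMeasurePreserving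
  filter_upwards [V.coeFn_compLpL (leftTranslation H h ξ), leftTranslation_ae_eq h ξ,
    leftTranslation_ae_eq h (V.compLpL 2 (haar : Measure G) ξ),
    hq.ae (V.coeFn_compLpL (p := 2) ξ)] with g h1 h2 h3 h4
  rw [h1, h2, h3, h4]

lemma compLpL_leftRegular (V : H →L[ℂ] K) (l : GroupCStar G) (ξ : L2 G H) :
    V.compLpL 2 (haar : Measure G) ((leftRegular H).cstarRep l ξ) =
      (leftRegular K).cstarRep l (V.compLpL 2 haar ξ) :=
  cstarRep_intertwine _ _ (V.compLpL 2 (haar : Measure G))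
    (fun g x => compLpL_leftTranslation V g x) l ξ

variable {A : Type u} [NonUnitalCStarAlgebra A] (α : G →* (A ≃⋆ₐ[ℂ] A))

/-- An intertwiner of representations of `A` intertwines the induced operators on `L²`. -/
lemma compLpL_induced {π : A →⋆ₙₐ[ℂ] (H →L[ℂ] H)} {ρ : A →⋆ₙₐ[ℂ] (K →L[ℂ] K)} (V : H →L[ℂ] K)
    (hV : ∀ b x, V (π b x) = ρ b (V x)) (a : A) (ξ : (induced (G := G) α π a).domain) :
    ∃ h : V.compLpL 2 (haar : Measure G) (ξ : L2 G H) ∈ (induced (G := G) α ρ a).domain,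
      induced α ρ a ⟨V.compLpL 2 haar (ξ : L2 G H), h⟩ =
        V.compLpL 2 (haar : Measure G) (induced α π a ξ) := by
  have hc := V.coeFn_compLpL (p := 2) (μ := (haar : Measure G)) (ξ : L2 G H)
  have h : V.compLpL 2 (haar : Measure G) (ξ : L2 G H) ∈ (induced (G := G) α ρ a).domain := by
    change AEStronglyMeasurable _ _
    have hξ : AEStronglyMeasurable (fun g => π (α g⁻¹ a) ((ξ : L2 G H) g)) (haar : Measure G) := ξ.2
    refine (V.continuous.comp_aestronglyMeasurable hξ).congr ?_
    filter_upwards [hc] with g hg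
    rw [hg, hV]
  refine ⟨h, Lp.ext ?_⟩
  filter_upwards [hc, induced_ae_eq α ρ a ⟨_, h⟩, induced_ae_eq α π a ξ,
    V.coeFn_compLpL (p := 2) (μ := (haar : Measure G)) (induced α π a ξ)] with g h1 h2 h3 h4
  rw [h2, h4, h3, hV]
  exact congrArg _ h1

lemma CovariantRep.π_act {α : G →* (A ≃⋆ₐ[ℂ] A)} (W : CovariantRep α H) (g : G) (a : A) (x : H) :
    W.π (α g⁻¹ a) x =
      (W.toUnitaryRep.U g⁻¹ : H →L[ℂ] H) (W.π a ((W.toUnitaryRep.U g : H →L[ℂ] H) x)) := by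
  rw [← W.covariant g⁻¹ a, UnitaryRep.star_apply, inv_inv]
  rfl

/-- Strong continuity becomes joint continuity because unitaries are isometric: replacing `φ x` by
`φ x₀` costs `‖φ x - φ x₀‖`, whatever the group element. -/
lemma UnitaryRep.continuous_apply_comp (W : UnitaryRep G H) {X : Type*} [TopologicalSpace X]
    {γ : X → G} {φ : X → H} (hγ : Continuous γ) (hφ : Continuous φ) :
    Continuous fun x => (W.U (γ x) : H →L[ℂ] H) (φ x) := by
  rw [continuous_iff_continuousAt]
  intro x₀
  have h1 : Filter.Tendsto (fun x => (W.U (γ x) : H →L[ℂ] H) (φ x₀)) (nhds x₀)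
      (nhds ((W.U (γ x₀) : H →L[ℂ] H) (φ x₀))) :=
    ((W.strong_continuous (φ x₀)).comp hγ).continuousAt
  have h2 : Filter.Tendsto (fun x => (W.U (γ x) : H →L[ℂ] H) (φ x - φ x₀)) (nhds x₀) (nhds 0) := by
    rw [tendsto_zero_iff_norm_tendsto_zero]
    simp only [norm_unitary_apply]
    rw [← tendsto_zero_iff_norm_tendsto_zero]
    have := (hφ.tendsto x₀).sub_const (φ x₀)
    rwa [sub_self] at this
  have := h1.add h2
  simpa only [ContinuousAt, ← map_add, add_sub_cancel, add_zero] using this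

/-- A continuous function is almost everywhere strongly measurable on sets of finite Haar
measure. -/
lemma aestronglyMeasurable_restrict_of_continuous {F : G → H} (hF : Continuous F) {B : Set G}
    (hB : MeasurableSet B) (hfin : (haar : Measure G) B ≠ ∞) :
    AEStronglyMeasurable F ((haar : Measure G).restrict B) := by
  -- Neither `G` nor `H` is assumed second countable, so continuity alone does not give strong
  -- measurability. Inner regularity exhausts `B`, up to a null set, by countably many compact sets,
  -- and on each of them `F` has compact image.
  have hex : ∀ n : ℕ, ∃ k ⊆ B, IsCompact k ∧ IsClosed k ∧
      (haar : Measure G) (B \ k) < ENNReal.ofReal (1 / (n + 1 : ℝ)) := fun n =>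
    hB.exists_isCompact_isClosed_sdiff_lt hfin
      (by rw [ne_eq, ENNReal.ofReal_eq_zero, not_le]; positivity)
  choose k hkB hkc hkcl hk using hex
  have hzero : (haar : Measure G) (B \ ⋃ n, k n) = 0 := by
    have htend : Filter.Tendsto (fun n : ℕ => ENNReal.ofReal (1 / (n + 1 : ℝ))) Filter.atTop
        (nhds 0) := by
      rw [← ENNReal.ofReal_zero]
      exact ENNReal.tendsto_ofReal tendsto_one_div_add_atTop_nhds_zero_nat
    refine le_antisymm (ge_of_tendsto' htend fun n => ?_) zero_le
    exact (measure_mono (Set.sdiff_subset_sdiff_right (Set.subset_iUnion k n))).trans (hk n).le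
  have hU : (⋃ n, k n) =ᵐ[haar] B :=
    (Set.iUnion_subset hkB).eventuallyLE.antisymm (ae_le_set.mpr hzero)
  rw [← restrict_congr_set hU, aestronglyMeasurable_iUnion_iff]
  exact fun n => hF.continuousOn.aestronglyMeasurable_of_isCompact (hkc n) (hkcl n).measurableSet

/-- An `L²`-convergent sequence has an almost everywhere convergent subsequence, and each operator
`π(α_{g⁻¹}(a))` is continuous. -/
lemma isClosed_inducedDomain (α : G →* (A ≃⋆ₐ[ℂ] A)) (π : A →⋆ₙₐ[ℂ] (H →L[ℂ] H)) (a : A) :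
    IsClosed (inducedDomain (G := G) α π a : Set (L2 G H)) := by
  refine IsSeqClosed.isClosed fun φ ξ hφ hξ => ?_
  change AEStronglyMeasurable (fun g => π (α g⁻¹ a) (ξ g)) (haar : Measure G)
  obtain ⟨ns, -, hns⟩ := (tendstoInMeasure_of_tendsto_Lp hξ).exists_seq_tendsto_ae
  refine aestronglyMeasurable_of_tendsto_ae Filter.atTop
    (f := fun n g => π (α g⁻¹ a) (φ (ns n) g)) (fun n => hφ (ns n)) ?_
  filter_upwards [hns] with g hg
  exact ((π (α g⁻¹ a)).continuous.tendsto _).comp hg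

/-- For a covariant representation the induced operators are everywhere defined. -/
lemma CovariantRep.inducedDomain_eq_top {α : G →* (A ≃⋆ₐ[ℂ] A)} (W : CovariantRep α H) (a : A) :
    inducedDomain α W.π a = ⊤ := by
  rw [eq_top_iff]
  rintro ξ -
  refine Lp.induction (by simp) (fun ξ => ξ ∈ inducedDomain α W.π a) ?_ ?_ ?_ ξ
  · intro v B hB hfin
    change AEStronglyMeasurable (fun g => W.π (α g⁻¹ a) _) (haar : Measure G)
    -- Covariance turns the function into `g ↦ U_{g⁻¹} π(a) U_g v`, which is continuous even if `α`
    -- is not.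
    have hcont : Continuous fun g => W.π (α g⁻¹ a) v := by
      simp only [W.π_act]
      exact W.continuous_apply_comp continuous_inv
        ((W.π a).continuous.comp (W.continuous_apply_comp continuous_id continuous_const))
    have h1 := aestronglyMeasurable_restrict_of_continuous hcont hB hfin.ne
    rw [← aestronglyMeasurable_indicator_iff hB] at h1
    refine h1.congr ?_
    filter_upwards [indicatorConstLp_coeFn (p := 2) (hs := hB) (hμs := hfin.ne) (c := v)]
      with g hg
    rw [Lp.simpleFunc.coe_indicatorConst, hg]
    by_cases h : g ∈ B <;> simp [h]
  · intro φ ψ hφ hψ _ h1 h2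
    exact add_mem h1 h2
  · exact isClosed_inducedDomain α W.π a

end L2

/-! ### Domination by the universal representation -/

section Compare

variable {G : Type u} [Group G] [TopologicalSpace G] [IsTopologicalGroup G] [LocallyCompactSpace G]
  [MeasurableSpace G] [BorelSpace G]
variable {H : Type u} [NormedAddCommGroup H] [InnerProductSpace ℂ H] [CompleteSpace H]
variable {A : Type u} [NonUnitalCStarAlgebra A]

lemma norm_le_compNorm (α : G →* (A ≃⋆ₐ[ℂ] A)) (π : A →⋆ₙₐ[ℂ] (H →L[ℂ] H)) (a : A)
    (S : L2 G H →L[ℂ] L2 G H) (ξ : L2 G H) (h : S ξ ∈ (induced α π a).domain) :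
    ‖induced α π a ⟨S ξ, h⟩‖ ≤ compNorm (induced α π a) S * ‖ξ‖ := by
  by_cases hξ : ξ = 0
  · subst hξ
    have : (⟨S 0, h⟩ : (induced (G := G) α π a).domain) = 0 := Subtype.ext (map_zero S)
    rw [this, LinearPMap.map_zero]; simp
  have hpos : 0 < ‖ξ‖ := norm_pos_iff.mpr hξ
  set c : ℂ := ((‖ξ‖⁻¹ : ℝ) : ℂ) with hc
  have hcn : ‖c‖ = ‖ξ‖⁻¹ := by rw [hc, Complex.norm_real, norm_inv, norm_norm]
  have h' : S (c • ξ) ∈ (induced α π a).domain := by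
    rw [map_smul]; exact Submodule.smul_mem _ c h
  have heq : induced α π a ⟨S (c • ξ), h'⟩ = c • induced α π a ⟨S ξ, h⟩ := by
    rw [← LinearPMap.map_smul]
    congr 1
    exact Subtype.ext (map_smul S c ξ)
  have hle : ‖induced α π a ⟨S (c • ξ), h'⟩‖ ≤ compNorm (induced α π a) S :=
    le_csSup (bddAbove_compNorm_induced α π a S)
      ⟨c • ξ, h', by rw [norm_smul, hcn, inv_mul_cancel₀ hpos.ne'], rfl⟩
  rw [heq, norm_smul, hcn, inv_mul_le_iff₀ hpos, mul_comm] at hle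
  exact hle

lemma compNorm_nonneg {E : Type u} [NormedAddCommGroup E] [NormedSpace ℂ E] (T : E →ₗ.[ℂ] E)
    (S : E →L[ℂ] E) : 0 ≤ compNorm T S :=
  Real.sSup_nonneg (by rintro _ ⟨_, _, _, rfl⟩; exact norm_nonneg _)

/-- Pointwise application of orthogonal projections is orthogonal in `L²`. -/
lemma norm_sq_compLpL_add {Q P : H →L[ℂ] H} (hQ : IsStarProjection Q) (hQP : Q * P = 0)
    (η : L2 G H) :
    ‖(Q + P).compLpL 2 (haar : Measure G) η‖ ^ 2 =
      ‖Q.compLpL 2 (haar : Measure G) η‖ ^ 2 + ‖P.compLpL 2 (haar : Measure G) η‖ ^ 2 := by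
  have h0 : inner ℂ (Q.compLpL 2 (haar : Measure G) η) (P.compLpL 2 (haar : Measure G) η) = 0 := by
    rw [L2.inner_def]
    refine integral_eq_zero_of_ae ?_
    filter_upwards [Q.coeFn_compLpL (p := 2) η, P.coeFn_compLpL (p := 2) η] with g h1 h2
    rw [h1, h2, Pi.zero_apply, ← ContinuousLinearMap.adjoint_inner_right,
      ← ContinuousLinearMap.star_eq_adjoint, hQ.isSelfAdjoint.star_eq]
    have : Q (P (η g)) = 0 := congrArg (fun T : H →L[ℂ] H => T (η g)) hQP
    rw [this, inner_zero_right]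
  rw [ContinuousLinearMap.add_compLpL, _root_.add_apply, sq, sq, sq]
  exact norm_add_sq_eq_norm_sq_add_norm_sq_of_inner_eq_zero _ _ h0

lemma norm_compLpL_apply_le (Q : H →L[ℂ] H) (hQ : ‖Q‖ ≤ 1) (η : L2 G H) :
    ‖Q.compLpL 2 (haar : Measure G) η‖ ≤ ‖η‖ := by
  refine (ContinuousLinearMap.le_opNorm _ _).trans ?_
  have := (Q.norm_compLpL_le (p := 2) (μ := (haar : Measure G))).trans hQ
  exact mul_le_of_le_one_left (norm_nonneg _) this

variable [PartialOrder A] [StarOrderedRing A]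

/-- If `T` is bounded by `c` after applying any intertwiner into the universal representation, then
it is bounded by `c` on the pieces of `L²(G, H)` cut out by sufficiently large projections in the
commutant of `π`. -/
lemma exists_large_projection (π : A →⋆ₙₐ[ℂ] (H →L[ℂ] H)) (T : L2 G H → L2 G H) {c : ℝ}
    (hc : 0 ≤ c)
    (hT : ∀ J : H →L[ℂ] UniversalSpace A, (∀ b x, J (π b x) = universalRep A b (J x)) →
      ∀ ξ, ‖J.compLpL 2 (haar : Measure G) (T ξ)‖ ≤ c * ‖J.compLpL 2 (haar : Measure G) ξ‖)
    (F : Finset H) :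
    ∃ Q : H →L[ℂ] H, IsStarProjection Q ∧ (∀ b, Commute Q (π b)) ∧
      (∀ ξ, ‖Q.compLpL 2 (haar : Measure G) (T ξ)‖ ≤ c * ‖Q.compLpL 2 (haar : Measure G) ξ‖) ∧
      ∀ v ∈ F, ∀ b, Q (π b v) = π b v := by
  classical
  induction F using Finset.induction_on with
  | empty =>
    refine ⟨0, .zero _, fun b => .zero_left _, fun ξ => ?_, by simp⟩
    have h0 : ∀ η : L2 G H, (0 : H →L[ℂ] H).compLpL 2 (haar : Measure G) η = 0 := fun η => by
      refine Lp.ext ?_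
      filter_upwards [(0 : H →L[ℂ] H).coeFn_compLpL (p := 2) η,
        Lp.coeFn_zero H 2 (haar : Measure G)] with g h1 h2
      rw [h1, h2]; rfl
    rw [h0, h0]; simp
  | insert v F _ ih =>
    obtain ⟨Q, hQ, hQc, hQT, hQF⟩ := ih
    -- The vector `v - Q v` is orthogonal to the range of `Q`, and `Q` commutes with `π`, so the new
    -- cyclic subspace is orthogonal to that range as well.
    obtain ⟨J, P, hJ, hP, hPc, hJP, hPv, hPQ⟩ := exists_universal_intertwiner π (v - Q v)
    have hQQ : ∀ x, Q (Q x) = Q x := fun x =>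
      congrArg (fun T : H →L[ℂ] H => T x) hQ.isIdempotentElem
    have hQπ : ∀ b x, Q (π b x) = π b (Q x) := fun b x =>
      congrArg (fun T : H →L[ℂ] H => T x) (hQc b)
    have hPπ : ∀ b x, P (π b x) = π b (P x) := fun b x =>
      congrArg (fun T : H →L[ℂ] H => T x) (hPc b)
    have h1 : Q * P = 0 := hPQ Q fun b => by rw [hQπ, map_sub, hQQ, sub_self, map_zero]
    have h2 : P * Q = 0 := by
      have := congrArg star h1
      rwa [star_mul, hQ.isSelfAdjoint.star_eq, hP.isSelfAdjoint.star_eq, star_zero] at this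
    have hPQ0 : ∀ x, P (Q x) = 0 := fun x => congrArg (fun T : H →L[ℂ] H => T x) h2
    refine ⟨Q + P, hQ.add hP h1, fun b => (hQc b).add_left (hPc b), fun ξ => ?_, ?_⟩
    · have hnJ : ∀ η : L2 G H, ‖J.compLpL 2 (haar : Measure G) η‖ =
          ‖P.compLpL 2 (haar : Measure G) η‖ := fun η => by
        refine le_antisymm (Lp.norm_le_norm_of_ae_le ?_) (Lp.norm_le_norm_of_ae_le ?_) <;>
        · filter_upwards [J.coeFn_compLpL (p := 2) η, P.coeFn_compLpL (p := 2) η] with g h1 h2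
          rw [h1, h2, hJP]
      have h3 := hT J hJ ξ
      rw [hnJ, hnJ] at h3
      -- By orthogonality the squared bounds for `Q` and `P` add up with the same constant `c`.
      refine le_of_sq_le_sq ?_ (mul_nonneg hc (norm_nonneg _))
      rw [mul_pow, norm_sq_compLpL_add hQ h1, norm_sq_compLpL_add hQ h1, mul_add, ← mul_pow,
        ← mul_pow]
      exact add_le_add (pow_le_pow_left₀ (norm_nonneg _) (hQT ξ) 2)
        (pow_le_pow_left₀ (norm_nonneg _) h3 2)
    · intro u hu b
      rw [_root_.add_apply]
      rcases Finset.mem_insert.mp hu with rfl | hu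
      · have h4 := hPv b
        rw [map_sub, map_sub, ← hQπ, hPQ0, sub_zero] at h4
        rw [h4, add_sub_cancel]
      · rw [← hQF u hu b, hPQ0, hQQ, add_zero]

/-- If all values of `T` lie in the essential subspace of `π` then, in the situation of
`exists_large_projection`, `T` is bounded by `c`. -/
lemma norm_le_of_intertwiners (π : A →⋆ₙₐ[ℂ] (H →L[ℂ] H)) (T : L2 G H → L2 G H) {c : ℝ}
    (hc : 0 ≤ c)
    (hT : ∀ J : H →L[ℂ] UniversalSpace A, (∀ b x, J (π b x) = universalRep A b (J x)) →
      ∀ ξ, ‖J.compLpL 2 (haar : Measure G) (T ξ)‖ ≤ c * ‖J.compLpL 2 (haar : Measure G) ξ‖)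
    (hmem : ∀ ξ, ∀ᵐ g ∂(haar : Measure G), ∃ b x, T ξ g = π b x) (ξ : L2 G H) :
    ‖T ξ‖ ≤ c * ‖ξ‖ := by
  classical
  -- `K` is the essential subspace of `π`. The projections available fix the vectors `π(b) v` but
  -- possibly not `v` itself; on `K` the distinction disappears, since a vector of `K` killed by all
  -- `π(b)` is zero.
  let K : Submodule ℂ H := (Submodule.span ℂ {y | ∃ b x, y = π b x}).topologicalClosure
  have hK : IsClosed (K : Set H) := Submodule.isClosed_topologicalClosure _
  have : CompleteSpace K := hK.completeSpace_coe
  have hmemK : ∀ b x, π b x ∈ K := fun b x =>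
    Submodule.le_topologicalClosure _ (Submodule.subset_span ⟨b, x, rfl⟩)
  have hzero : ∀ y ∈ K, (∀ b, π b y = 0) → y = 0 := by
    intro y hy h
    have : ∀ z ∈ K, inner ℂ z y = 0 := by
      intro z hz
      refine closure_minimal (t := {z | inner ℂ z y = 0}) ?_
        (isClosed_eq (by fun_prop) (by fun_prop)) hz
      intro w hw
      change inner ℂ w y = 0
      induction hw using Submodule.span_induction with
      | mem w hw =>
        obtain ⟨b, x, rfl⟩ := hw
        have := ContinuousLinearMap.adjoint_inner_right (π b) x y
        rw [← this, ← ContinuousLinearMap.star_eq_adjoint, ← map_star, h, inner_zero_right]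
      | zero => exact inner_zero_left _
      | add w z _ _ hw hz => rw [inner_add_left, hw, hz, add_zero]
      | smul r w _ hw => rw [inner_smul_left, hw, mul_zero]
    exact inner_self_eq_zero.mp (this y hy)
  let E : H →L[ℂ] H := K.starProjection
  have hE1 : ‖E‖ ≤ 1 := K.starProjection_norm_le
  refine le_of_forall_pos_le_add fun ε hε => ?_
  obtain ⟨s, hs⟩ : ∃ s : Lp.simpleFunc H 2 (haar : Measure G), ‖T ξ - s‖ ≤ ε / 2 := by
    have := (Lp.simpleFunc.denseRange (E := H) (p := 2) (μ := (haar : Measure G))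
      (by simp)).exists_dist_lt (T ξ) (half_pos hε)
    obtain ⟨s, hs⟩ := this
    exact ⟨s, by rw [← dist_eq_norm]; exact hs.le⟩
  -- A simple function has finitely many values; projected to `K`, they form the finite set that `Q`
  -- must handle.
  obtain ⟨Q, hQ, hQc, hQT, hQF⟩ := exists_large_projection π T hc hT
    ((Lp.simpleFunc.toSimpleFunc s).range.image E)
  have hQ1 : ‖Q‖ ≤ 1 := hQ.norm_le
  have hQπ : ∀ b x, Q (π b x) = π b (Q x) := fun b x =>
    congrArg (fun T : H →L[ℂ] H => T x) (hQc b)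
  have hQK : ∀ y ∈ K, Q y ∈ K := by
    intro y hy
    refine closure_minimal (t := {z | Q z ∈ K}) ?_ (hK.preimage Q.continuous) hy
    intro w hw
    change Q w ∈ K
    induction hw using Submodule.span_induction with
    | mem w hw =>
      obtain ⟨b, x, rfl⟩ := hw
      rw [hQπ]; exact hmemK _ _
    | zero => rw [map_zero]; exact zero_mem _
    | add w z _ _ hw hz => rw [map_add]; exact add_mem hw hz
    | smul r w _ hw => rw [map_smul]; exact Submodule.smul_mem _ r hw
  set q := Q.compLpL 2 (haar : Measure G) with hq
  set e := E.compLpL 2 (haar : Measure G) with he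
  have heT : e (T ξ) = T ξ := by
    refine Lp.ext ?_
    filter_upwards [E.coeFn_compLpL (p := 2) (T ξ), hmem ξ] with g h1 h2
    obtain ⟨b, x, h2⟩ := h2
    rw [h1, h2]
    exact Submodule.starProjection_eq_self_iff.mpr (hmemK b x)
  have hqs : q (e s) = e s := by
    refine Lp.ext ?_
    filter_upwards [Q.coeFn_compLpL (p := 2) (e s),
      E.coeFn_compLpL (p := 2) (s : L2 G H), Lp.simpleFunc.toSimpleFunc_eq_toFun s] with g h1 h2 h3
    rw [h1, h2, ← h3]
    have hmF : E (Lp.simpleFunc.toSimpleFunc s g) ∈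
        (Lp.simpleFunc.toSimpleFunc s).range.image E :=
      Finset.mem_image_of_mem _ (SimpleFunc.mem_range_self _ _)
    have hmK : E (Lp.simpleFunc.toSimpleFunc s g) ∈ K := K.starProjection_apply_mem _
    rw [← sub_eq_zero]
    refine hzero _ (sub_mem (hQK _ hmK) hmK) fun b => ?_
    rw [map_sub, ← hQπ, hQF _ hmF, sub_self]
  have h1 : ‖T ξ - e s‖ ≤ ε / 2 := by
    have : T ξ - e s = e (T ξ - s) := by rw [map_sub, heT]
    rw [this]
    exact (norm_compLpL_apply_le E hE1 _).trans hs
  -- Since `q` fixes `e s`, the part of `T ξ` missed by `q` comes only from the approximation error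
  -- `T ξ - e s`.
  have h2 : T ξ = q (T ξ) + ((T ξ - e s) - q (T ξ - e s)) := by
    rw [map_sub, hqs]; abel
  have h3 : ‖q (T ξ)‖ ≤ c * ‖ξ‖ :=
    (hQT ξ).trans (mul_le_mul_of_nonneg_left (norm_compLpL_apply_le Q hQ1 ξ) hc)
  calc ‖T ξ‖ = ‖q (T ξ) + ((T ξ - e s) - q (T ξ - e s))‖ := by rw [← h2]
    _ ≤ ‖q (T ξ)‖ + (‖T ξ - e s‖ + ‖q (T ξ - e s)‖) :=
      (norm_add_le _ _).trans (add_le_add_right (norm_sub_le _ _) _)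
    _ ≤ c * ‖ξ‖ + (ε / 2 + ε / 2) := by
      gcongr
      exact (norm_compLpL_apply_le Q hQ1 _).trans h1
    _ = c * ‖ξ‖ + ε := by ring

/-- The induced operators of a covariant representation are dominated by those of the universal
representation. -/
lemma CovariantRep.norm_induced_leftRegular_le {α : G →* (A ≃⋆ₐ[ℂ] A)} (W : CovariantRep α H)
    (a : A) (l : GroupCStar G) (ξ : L2 G H)
    (h : (leftRegular H).cstarRep l ξ ∈ (induced α W.π a).domain) :
    ‖induced α W.π a ⟨(leftRegular H).cstarRep l ξ, h⟩‖ ≤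
      compNorm (induced α (universalRep A) a) ((leftRegular (UniversalSpace A)).cstarRep l) *
        ‖ξ‖ := by
  have hdom : ∀ η : L2 G H, η ∈ (induced (G := G) α W.π a).domain := fun η => by
    change η ∈ inducedDomain α W.π a
    rw [W.inducedDomain_eq_top]; trivial
  refine norm_le_of_intertwiners W.π
    (fun ξ => induced α W.π a ⟨(leftRegular H).cstarRep l ξ, hdom _⟩)
    (compNorm_nonneg _ _) (fun J hJ ξ => ?_) (fun ξ => ?_) ξ
  -- Pointwise application of `J` carries `π̃(a) λ_L(l) ξ` to `π̃_u(a) λ_L(l)` applied to the image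
  -- of `ξ`, where the bound is the definition of the supremum.
  · obtain ⟨h', he⟩ := compLpL_induced α J hJ a ⟨(leftRegular H).cstarRep l ξ, hdom _⟩
    rw [← he]
    simp only [compLpL_leftRegular] at h' ⊢
    exact norm_le_compNorm α _ a _ _ h'
  · filter_upwards [induced_ae_eq α W.π a ⟨(leftRegular H).cstarRep l ξ, hdom _⟩] with g hg
    exact ⟨_, _, hg⟩

end Compare

/-! ### Translations and densities in the dual of `C_b(G)` -/

section Reiter

open scoped Topology Pointwise BoundedContinuousFunction

variable {G : Type u} [Group G] [TopologicalSpace G]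

variable (G) in
/-- The Banach space of bounded continuous functions. -/
def Cb : Type u := G →ᵇ ℝ

instance : NormedAddCommGroup (Cb G) := inferInstanceAs (NormedAddCommGroup (G →ᵇ ℝ))
instance : NormedSpace ℝ (Cb G) := inferInstanceAs (NormedSpace ℝ (G →ᵇ ℝ))
instance : FunLike (Cb G) G ℝ := inferInstanceAs (FunLike (G →ᵇ ℝ) G ℝ)

/-- The constant function one. -/
def Cb.one : Cb G := BoundedContinuousFunction.const G 1

lemma Cb.continuous (φ : Cb G) : Continuous φ := BoundedContinuousFunction.continuous φ

lemma Cb.norm_apply_le (φ : Cb G) (x : G) : ‖φ x‖ ≤ ‖φ‖ :=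
  BoundedContinuousFunction.norm_coe_le_norm φ x

@[ext]
lemma Cb.ext {φ ψ : Cb G} (h : ∀ x, φ x = ψ x) : φ = ψ := BoundedContinuousFunction.ext h

lemma Cb.add_apply (φ ψ : Cb G) (x : G) : (φ + ψ) x = φ x + ψ x := rfl

lemma Cb.smul_apply (c : ℝ) (φ : Cb G) (x : G) : (c • φ) x = c * φ x := rfl

variable (G) in
/-- The dual of the space of bounded continuous functions. -/
abbrev CbDual : Type u := Cb G →L[ℝ] ℝ

/-- Composition with a continuous map as an operator on bounded continuous functions. -/
def compCLM (γ : C(G, G)) : Cb G →L[ℝ] Cb G :=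
  LinearMap.mkContinuous
    { toFun := fun φ => BoundedContinuousFunction.compContinuous φ γ
      map_add' := fun _ _ => rfl
      map_smul' := fun _ _ => rfl } 1 fun φ => by
    rw [one_mul]
    exact (BoundedContinuousFunction.norm_le (norm_nonneg _)).mpr fun x => φ.norm_apply_le _

lemma norm_comp_compCLM_le (γ : C(G, G)) (T : CbDual G) : ‖T ∘L compCLM γ‖ ≤ ‖T‖ := by
  have h1 : ‖compCLM γ‖ ≤ 1 := LinearMap.mkContinuous_norm_le _ zero_le_one _
  calc ‖T ∘L compCLM γ‖ ≤ ‖T‖ * ‖compCLM γ‖ := T.opNorm_comp_le _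
    _ ≤ ‖T‖ := mul_le_of_le_one_right (norm_nonneg T) h1

variable [IsTopologicalGroup G]

/-- Left translation on the dual of `C_b(G)`. -/
def leftShift (h : G) (T : CbDual G) : CbDual G :=
  T ∘L compCLM ⟨fun x => h * x, continuous_const_mul h⟩

/-- Right translation on the dual of `C_b(G)`. -/
def rightShift (g : G) (T : CbDual G) : CbDual G :=
  T ∘L compCLM ⟨fun x => x * g, continuous_mul_const g⟩

lemma leftShift_add (h : G) (S T : CbDual G) :
    leftShift h (S + T) = leftShift h S + leftShift h T := rfl

lemma leftShift_sub (h : G) (S T : CbDual G) :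
    leftShift h (S - T) = leftShift h S - leftShift h T := rfl

lemma leftShift_smul (h : G) (c : ℝ) (T : CbDual G) :
    leftShift h (c • T) = c • leftShift h T := rfl

lemma rightShift_sub (h : G) (S T : CbDual G) :
    rightShift h (S - T) = rightShift h S - rightShift h T := rfl

lemma norm_leftShift_le (h : G) (T : CbDual G) : ‖leftShift h T‖ ≤ ‖T‖ :=
  norm_comp_compCLM_le _ T

lemma norm_rightShift_le (h : G) (T : CbDual G) : ‖rightShift h T‖ ≤ ‖T‖ :=
  norm_comp_compCLM_le _ T

/-- This commutation, a form of associativity, transfers left-invariance estimates from one density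
to all its right translates. -/
lemma leftShift_rightShift (h g : G) (T : CbDual G) :
    leftShift h (rightShift g T) = rightShift g (leftShift h T) := by
  ext φ
  change T _ = T _
  congr 1
  ext x
  change φ (h * (x * g)) = φ (h * x * g)
  rw [mul_assoc]

lemma leftShift_mul (h n : G) (T : CbDual G) : leftShift (h * n) T = leftShift h (leftShift n T) := by
  ext φ
  change T _ = T _
  congr 1
  ext x
  change φ (h * n * x) = φ (h * (n * x))
  rw [mul_assoc]

lemma rightShift_mul (g h : G) (T : CbDual G) :
    rightShift g (rightShift h T) = rightShift (h * g) T := by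
  ext φ
  change T _ = T _
  congr 1
  ext x
  change φ (x * h * g) = φ (x * (h * g))
  rw [mul_assoc]

variable [LocallyCompactSpace G] [MeasurableSpace G] [BorelSpace G]

lemma integrable_mul_bounded (p : CompactlySupportedContinuousMap G ℝ) {φ : G → ℝ}
    (hφ : Continuous φ) : Integrable (fun x => p x * φ x) (haar : Measure G) :=
  (p.continuous.mul hφ).integrable_of_hasCompactSupport p.hasCompactSupport.mul_right

lemma integrable_compactlySupported (p : CompactlySupportedContinuousMap G ℝ) :
    Integrable p (haar : Measure G) :=
  p.continuous.integrable_of_hasCompactSupport p.hasCompactSupport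

/-- The functional `φ ↦ ∫ p φ` on `C_b(G)` with density `p ∈ C_c(G)`. -/
def density (p : CompactlySupportedContinuousMap G ℝ) : CbDual G :=
  LinearMap.mkContinuous
    { toFun := fun φ => ∫ x, p x * φ x ∂(haar : Measure G)
      map_add' := fun φ ψ => by
        simp only [Cb.add_apply, mul_add]
        exact integral_add (integrable_mul_bounded p φ.continuous)
          (integrable_mul_bounded p ψ.continuous)
      map_smul' := fun c φ => by
        simp only [Cb.smul_apply, smul_eq_mul, RingHom.id_apply,
          mul_left_comm _ c]
        exact integral_const_mul c _ }
    (∫ x, |p x| ∂(haar : Measure G)) fun φ => by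
      refine (norm_integral_le_integral_norm _).trans ?_
      rw [← integral_mul_const]
      refine integral_mono (integrable_mul_bounded p φ.continuous).norm
        ((integrable_compactlySupported p).abs.mul_const _) fun x => ?_
      change ‖p x * φ x‖ ≤ |p x| * ‖φ‖
      rw [norm_mul, Real.norm_eq_abs]
      exact mul_le_mul_of_nonneg_left (φ.norm_apply_le x) (abs_nonneg _)

lemma density_apply (p : CompactlySupportedContinuousMap G ℝ) (φ : Cb G) :
    density p φ = ∫ x, p x * φ x ∂(haar : Measure G) := rfl

lemma norm_density_le (p : CompactlySupportedContinuousMap G ℝ) :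
    ‖density p‖ ≤ ∫ x, |p x| ∂(haar : Measure G) :=
  LinearMap.mkContinuous_norm_le _ (integral_nonneg fun _ => abs_nonneg _) _

lemma density_add (p q : CompactlySupportedContinuousMap G ℝ) :
    density (p + q) = density p + density q := by
  ext φ
  rw [_root_.add_apply, density_apply, density_apply, density_apply,
    ← integral_add (integrable_mul_bounded p φ.continuous) (integrable_mul_bounded q φ.continuous)]
  exact integral_congr_ae (.of_forall fun x => add_mul _ _ _)

lemma density_smul (c : ℝ) (p : CompactlySupportedContinuousMap G ℝ) :
    density (c • p) = c • density p := by
  ext φ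
  rw [_root_.smul_apply, density_apply, density_apply, smul_eq_mul, ← integral_const_mul]
  exact integral_congr_ae (.of_forall fun x => mul_assoc _ _ _)

lemma density_sub (p q : CompactlySupportedContinuousMap G ℝ) :
    density (p - q) = density p - density q := by
  ext φ
  rw [_root_.sub_apply, density_apply, density_apply, density_apply,
    ← integral_sub (integrable_mul_bounded p φ.continuous) (integrable_mul_bounded q φ.continuous)]
  exact integral_congr_ae (.of_forall fun x => sub_mul _ _ _)

/-- Testing against `p / (|p| + η)`, a continuous substitute for the sign of `p`, loses at most `η`
at each point of the support. With `norm_density_le`, the dual norm of a density is exactly its `L¹`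
norm. -/
lemma integral_abs_le_norm_density (p : CompactlySupportedContinuousMap G ℝ) :
    ∫ x, |p x| ∂(haar : Measure G) ≤ ‖density p‖ := by
  set K := tsupport p with hK
  have hKm : MeasurableSet K := (isClosed_tsupport _).measurableSet
  have hKfin : (haar : Measure G) K ≠ ∞ := p.hasCompactSupport.measure_lt_top.ne
  have hle : ∀ η : ℝ, 0 < η →
      ∫ x, |p x| ∂(haar : Measure G) ≤ ‖density p‖ + (haar : Measure G).real K * η := by
    intro η hη
    have hden : ∀ x, |p x| + η ≠ 0 := fun x => by positivity
    have hcont : Continuous fun x => p x / (|p x| + η) :=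
      p.continuous.div (p.continuous.abs.add continuous_const) hden
    have hbd : ∀ x, ‖p x / (|p x| + η)‖ ≤ 1 := fun x => by
      rw [norm_div, Real.norm_eq_abs, Real.norm_eq_abs,
        abs_of_pos (show 0 < |p x| + η by positivity)]
      exact (div_le_one (by positivity)).mpr (by linarith)
    let φ : Cb G := BoundedContinuousFunction.ofNormedAddCommGroup _ hcont 1 hbd
    have hφ : ‖φ‖ ≤ 1 := BoundedContinuousFunction.norm_ofNormedAddCommGroup_le _ zero_le_one hbd
    have h1 : density p φ ≤ ‖density p‖ :=
      (le_abs_self _).trans ((density p).unit_le_opNorm φ hφ)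
    have h2 : ∀ x, |p x| ≤ p x * φ x + η := fun x => by
      change |p x| ≤ p x * (p x / (|p x| + η)) + η
      have : p x * (p x / (|p x| + η)) = |p x| - η * (|p x| / (|p x| + η)) := by
        field_simp [hden x]
        rw [← sq_abs (p x)]; ring
      rw [this]
      have h3 : |p x| / (|p x| + η) ≤ 1 := (div_le_one (by positivity)).mpr (by linarith)
      nlinarith
    have h0 : ∀ x, x ∉ K → p x = 0 := fun x hx => image_eq_zero_of_notMem_tsupport hx
    calc ∫ x, |p x| ∂(haar : Measure G) = ∫ x in K, |p x| ∂(haar : Measure G) :=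
          (setIntegral_eq_integral_of_forall_compl_eq_zero fun x hx => by simp [h0 x hx]).symm
      _ ≤ ∫ x in K, (p x * φ x + η) ∂(haar : Measure G) :=
          integral_mono (integrable_compactlySupported p).abs.integrableOn
            ((integrable_mul_bounded p φ.continuous).integrableOn.add
              (integrableOn_const hKfin)) h2
      _ = (∫ x in K, p x * φ x ∂(haar : Measure G)) + ∫ x in K, η ∂(haar : Measure G) :=
          integral_add (integrable_mul_bounded p φ.continuous).integrableOn
            (integrableOn_const hKfin)
      _ = density p φ + (haar : Measure G).real K * η := by
          rw [setIntegral_const, smul_eq_mul, density_apply,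
            setIntegral_eq_integral_of_forall_compl_eq_zero fun x hx => by simp [h0 x hx]]
      _ ≤ _ := by gcongr
  refine le_of_forall_pos_le_add fun ε hε => ?_
  refine (hle (ε / ((haar : Measure G).real K + 1)) (by positivity)).trans ?_
  gcongr
  rw [mul_div_assoc', div_le_iff₀ (by positivity)]
  nlinarith [measureReal_nonneg (μ := (haar : Measure G)) (s := K)]

/-- The density `p` transported along a jointly continuous and proper family of maps depends
continuously on the parameter. -/
lemma continuous_density (p : CompactlySupportedContinuousMap G ℝ) {m : G → G → G}
    (hm : Continuous m.uncurry)
    (hk : ∀ g₀, ∃ N ∈ 𝓝 g₀, ∃ k : Set G, IsCompact k ∧ ∀ g ∈ N, ∀ x ∉ k, p (m g x) = 0)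
    (q : G → CompactlySupportedContinuousMap G ℝ) (hq : ∀ g x, q g x = p (m g x)) :
    Continuous fun g => density (q g) := by
  rw [continuous_iff_continuousAt]
  intro g₀
  obtain ⟨N, hN, k, hkc, hk⟩ := hk g₀
  have hg₀ : g₀ ∈ N := mem_of_mem_nhds hN
  -- For `g` near `g₀` the `L¹` distance is an integral of a jointly continuous function over one
  -- fixed compact set; hence it is continuous in `g`, and it vanishes at `g₀`.
  have hcont : ContinuousOn (fun g => ∫ x, |p (m g x) - p (m g₀ x)| ∂(haar : Measure G)) N := by
    refine continuousOn_integral_of_compact_support hkc ?_ fun g x hg hx => ?_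
    · have h1 : Continuous fun z : G × G => p (m z.1 z.2) := p.continuous.comp hm
      have h2 : Continuous fun z : G × G => p (m g₀ z.2) :=
        p.continuous.comp (hm.comp (Continuous.prodMk continuous_const continuous_snd))
      exact (h1.sub h2).abs.continuousOn
    · rw [hk g hg x hx, hk g₀ hg₀ x hx, sub_zero, abs_zero]
  have h0 := (hcont.continuousAt hN).tendsto
  simp only [sub_self, abs_zero, integral_zero] at h0
  refine (tendsto_iff_norm_sub_tendsto_zero (E := CbDual G)).mpr ?_
  refine squeeze_zero (fun g => norm_nonneg (density (q g) - density (q g₀))) (fun g => ?_) h0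
  rw [← density_sub]
  refine (norm_density_le _).trans (le_of_eq (integral_congr_ae (.of_forall fun x => ?_)))
  change |q g x - q g₀ x| = _
  rw [hq, hq]

/-- Left translate of a compactly supported function. -/
def leftTranslate {E : Type*} [TopologicalSpace E] [Zero E] (h : G)
    (p : CompactlySupportedContinuousMap G E) : CompactlySupportedContinuousMap G E :=
  ⟨⟨fun x => p (h⁻¹ * x), p.continuous.comp (continuous_const_mul h⁻¹)⟩,
    p.hasCompactSupport.comp_homeomorph (Homeomorph.mulLeft h⁻¹)⟩

/-- Right translate of a compactly supported function. -/
def rightTranslate {E : Type*} [TopologicalSpace E] [Zero E] (g : G)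
    (p : CompactlySupportedContinuousMap G E) : CompactlySupportedContinuousMap G E :=
  ⟨⟨fun x => p (x * g⁻¹), p.continuous.comp (continuous_mul_const g⁻¹)⟩,
    p.hasCompactSupport.comp_homeomorph (Homeomorph.mulRight g⁻¹)⟩

lemma leftShift_density (h : G) (p : CompactlySupportedContinuousMap G ℝ) :
    leftShift h (density p) = density (leftTranslate h p) := by
  ext φ
  change ∫ x, p x * φ (h * x) ∂(haar : Measure G) = ∫ x, p (h⁻¹ * x) * φ x ∂(haar : Measure G)
  rw [← integral_mul_left_eq_self (fun x => p (h⁻¹ * x) * φ x) h]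
  simp only [inv_mul_cancel_left]

lemma continuous_leftShift_density (p : CompactlySupportedContinuousMap G ℝ) :
    Continuous fun h => leftShift h (density p) := by
  simp only [leftShift_density]
  refine continuous_density p (m := fun h x => h⁻¹ * x) (by fun_prop) (fun g₀ => ?_) _
    fun _ _ => rfl
  obtain ⟨N, hNc, hN⟩ := exists_compact_mem_nhds g₀
  refine ⟨N, hN, N * tsupport p, hNc.mul p.hasCompactSupport, fun g hg x hx => ?_⟩
  refine image_eq_zero_of_notMem_tsupport fun h => hx ?_
  exact ⟨g, hg, g⁻¹ * x, h, by simp⟩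

lemma continuous_density_rightTranslate (p : CompactlySupportedContinuousMap G ℝ) :
    Continuous fun g => density (rightTranslate g p) := by
  refine continuous_density p (m := fun g x => x * g⁻¹) (by fun_prop) (fun g₀ => ?_) _
    fun _ _ => rfl
  obtain ⟨N, hNc, hN⟩ := exists_compact_mem_nhds g₀
  refine ⟨N, hN, tsupport p * N, p.hasCompactSupport.mul hNc, fun g hg x hx => ?_⟩
  refine image_eq_zero_of_notMem_tsupport fun h => hx ?_
  exact ⟨x * g⁻¹, h, g, hg, by simp⟩

/-- Right translation rescales left Haar measure by a constant; `c` is this modular factor. -/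
lemma exists_rightShift_density (g : G) : ∃ c : ℝ, 0 ≤ c ∧
    ∀ p : CompactlySupportedContinuousMap G ℝ,
      rightShift g (density p) = c • density (rightTranslate g p) := by
  have hreg : (Measure.map (· * g) (haar : Measure G)).Regular :=
    Regular.map (Homeomorph.mulRight g)
  have key := isMulLeftInvariant_eq_smul_of_regular (Measure.map (· * g) (haar : Measure G)) haar
  set c := haarScalarFactor (Measure.map (· * g) (haar : Measure G)) haar
  refine ⟨c, c.2, fun p => ?_⟩
  ext φ
  change ∫ x, p x * φ (x * g) ∂(haar : Measure G) =
    (c : ℝ) * ∫ x, p (x * g⁻¹) * φ x ∂(haar : Measure G)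
  have h1 : ∫ x, p (x * g⁻¹) * φ x ∂(Measure.map (· * g) (haar : Measure G)) =
      ∫ x, p x * φ (x * g) ∂haar := by
    refine ((Homeomorph.mulRight g).measurableEmbedding.integral_map _).trans ?_
    refine integral_congr_ae (.of_forall fun h => ?_)
    simp
  rw [← h1, key, integral_smul_nnreal_measure]
  rfl

variable (G) in
lemma exists_density_one : ∃ p : CompactlySupportedContinuousMap G ℝ,
    (∀ x, 0 ≤ p x) ∧ density p Cb.one = 1 := by
  obtain ⟨f, hfc, hf0, hf1⟩ := exists_continuous_nonneg_pos (1 : G)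
  have hpos : 0 < ∫ x, f x ∂(haar : Measure G) :=
    f.continuous.integral_pos_of_hasCompactSupport_nonneg_nonzero hfc hf0 hf1
  let p : CompactlySupportedContinuousMap G ℝ := ⟨f, hfc⟩
  have hp : density p Cb.one = ∫ x, f x ∂(haar : Measure G) := by
    rw [density_apply]
    exact integral_congr_ae (.of_forall fun x => mul_one _)
  refine ⟨(∫ x, f x ∂(haar : Measure G))⁻¹ • p, fun x => ?_, ?_⟩
  · exact mul_nonneg (inv_nonneg.mpr hpos.le) (hf0 x)
  · rw [density_smul, _root_.smul_apply, hp, smul_eq_mul, inv_mul_cancel₀ hpos.ne']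

lemma rightShift_apply_one (g : G) (T : CbDual G) : rightShift g T Cb.one = T Cb.one := rfl

lemma leftShift_apply_one (g : G) (T : CbDual G) : leftShift g T Cb.one = T Cb.one := rfl

/-- The modular factor is continuous in `g`: right translation preserves the mass of a density `q`
of mass one, so the factor is the reciprocal of the integral of a right translate of `q`. -/
lemma continuous_rightShift_density (p : CompactlySupportedContinuousMap G ℝ) :
    Continuous fun g => rightShift g (density p) := by
  choose c hc hcp using exists_rightShift_density (G := G)
  obtain ⟨q, -, hq⟩ := exists_density_one G
  have h1 : ∀ g, c g * density (rightTranslate g q) Cb.one = 1 := fun g => by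
    rw [← smul_eq_mul, ← _root_.smul_apply, ← hcp, rightShift_apply_one, hq]
  have hcc : Continuous c := by
    have h2 : ∀ g, c g = (density (rightTranslate g q) Cb.one)⁻¹ := fun g => eq_inv_of_mul_eq_one_left (h1 g)
    simp only [funext h2]
    refine Continuous.inv₀ ?_ fun g => right_ne_zero_of_mul_eq_one (h1 g)
    exact (continuous_density_rightTranslate q).clm_apply continuous_const
  simp only [hcp]
  exact hcc.smul (continuous_density_rightTranslate p)

end Reiter

/-! ### Reiter's property from an invariant mean -/

section Reiter

open scoped Topology Pointwise BoundedContinuousFunction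

variable {G : Type u} [Group G] [TopologicalSpace G] [IsTopologicalGroup G]

variable (G) in
/-- The functionals on which right translation acts norm-continuously. -/
def rightContinuous : Submodule ℝ (CbDual G) where
  carrier := {T | Continuous fun g => rightShift g T}
  zero_mem' := continuous_const (y := (0 : CbDual G))
  add_mem' hS hT := Continuous.add (M := CbDual G) hS hT
  smul_mem' c _ hT := Continuous.const_smul (α := CbDual G) hT c

/-- The bounded continuous function `g ↦ Λ (R_g T)`. -/
def orbitFunction (Λ : CbDual G →L[ℝ] ℝ) (T : rightContinuous G) : G →ᵇ ℝ :=
  BoundedContinuousFunction.ofNormedAddCommGroup (fun g => Λ (rightShift g (T : CbDual G)))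
    (Λ.continuous.comp T.2) (‖Λ‖ * ‖(T : CbDual G)‖) fun g =>
      (Λ.le_opNorm _).trans (mul_le_mul_of_nonneg_left (norm_rightShift_le g _) (norm_nonneg Λ))

lemma orbitFunction_apply (Λ : CbDual G →L[ℝ] ℝ) (T : rightContinuous G) (g : G) :
    orbitFunction Λ T g = Λ (rightShift g (T : CbDual G)) := rfl

lemma norm_orbitFunction_le (Λ : CbDual G →L[ℝ] ℝ) (T : rightContinuous G) :
    ‖orbitFunction Λ T‖ ≤ ‖Λ‖ * ‖(T : CbDual G)‖ :=
  BoundedContinuousFunction.norm_ofNormedAddCommGroup_le _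
    (mul_nonneg (norm_nonneg Λ) (norm_nonneg (T : CbDual G))) _

lemma mean_mono {m : (G →ᵇ ℝ) →ₗ[ℝ] ℝ} (hm : ∀ f : G →ᵇ ℝ, (∀ g, 0 ≤ f g) → 0 ≤ m f)
    {f f' : G →ᵇ ℝ} (h : ∀ g, f g ≤ f' g) : m f ≤ m f' := by
  have := hm (f' - f) fun g => by
    rw [BoundedContinuousFunction.sub_apply]; exact sub_nonneg.mpr (h g)
  rw [map_sub] at this
  exact sub_nonneg.mp this

lemma mean_const {m : (G →ᵇ ℝ) →ₗ[ℝ] ℝ} (h1 : m (BoundedContinuousFunction.const G 1) = 1)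
    (c : ℝ) : m (BoundedContinuousFunction.const G c) = c := by
  have : BoundedContinuousFunction.const G c = c • BoundedContinuousFunction.const G (1 : ℝ) := by
    ext; simp
  rw [this, map_smul, h1, smul_eq_mul, mul_one]

lemma abs_mean_le {m : (G →ᵇ ℝ) →ₗ[ℝ] ℝ} (hm : ∀ f : G →ᵇ ℝ, (∀ g, 0 ≤ f g) → 0 ≤ m f)
    (h1 : m (BoundedContinuousFunction.const G 1) = 1) (f : G →ᵇ ℝ) : |m f| ≤ ‖f‖ := by
  have hb : ∀ g, |f g| ≤ ‖f‖ := fun g => f.norm_coe_le_norm g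
  rw [abs_le]
  constructor
  · rw [← mean_const h1 (-‖f‖)]
    exact mean_mono hm fun g => (abs_le.mp (hb g)).1
  · rw [← mean_const h1 ‖f‖]
    exact mean_mono hm fun g => (abs_le.mp (hb g)).2

/-- Averaging `g ↦ Λ (R_g T)` with a mean extends to a bounded functional. -/
lemma exists_average {m : (G →ᵇ ℝ) →ₗ[ℝ] ℝ} (hm : ∀ f : G →ᵇ ℝ, (∀ g, 0 ≤ f g) → 0 ≤ m f)
    (h1 : m (BoundedContinuousFunction.const G 1) = 1) (Λ : CbDual G →L[ℝ] ℝ) :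
    ∃ ℓ : CbDual G →L[ℝ] ℝ, ∀ T : rightContinuous G, ℓ T = m (orbitFunction Λ T) := by
  let ℓ₀ : rightContinuous G →L[ℝ] ℝ := LinearMap.mkContinuous
    { toFun := fun T => m (orbitFunction Λ T)
      map_add' := fun S T => by
        rw [← map_add]
        congr 1
        ext g
        exact map_add Λ (rightShift g (S : CbDual G)) (rightShift g (T : CbDual G))
      map_smul' := fun c T => by
        rw [← map_smul]
        congr 1
        ext g
        exact map_smul Λ c (rightShift g (T : CbDual G)) }
    ‖Λ‖ fun T => (abs_mean_le hm h1 _).trans (norm_orbitFunction_le Λ T)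
  -- The mean can only be applied where orbit functions are continuous. Extending to the whole dual
  -- allows `ℓ` to be exchanged with integrals valued in `CbDual G`.
  obtain ⟨ℓ, hℓ, -⟩ := exists_extension_norm_eq (𝕜 := ℝ) (rightContinuous G) ℓ₀
  exact ⟨ℓ, hℓ⟩

variable [LocallyCompactSpace G] [MeasurableSpace G] [BorelSpace G]

lemma density_mem_rightContinuous (p : CompactlySupportedContinuousMap G ℝ) :
    density p ∈ rightContinuous G := continuous_rightShift_density p

/-- The two expressions for a convolution, as averages of right and of left translates. -/
lemma integral_rightShift_eq_integral_leftShift (p q : CompactlySupportedContinuousMap G ℝ) :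
    ∫ y, q y • rightShift y (density p) ∂(haar : Measure G) =
      ∫ x, p x • leftShift x (density q) ∂(haar : Measure G) := by
  have hR : Integrable (fun y => q y • rightShift y (density p)) (haar : Measure G) :=
    (q.continuous.smul (continuous_rightShift_density p)).integrable_of_hasCompactSupport
      q.hasCompactSupport.smul_right
  have hL : Integrable (fun x => p x • leftShift x (density q)) (haar : Measure G) :=
    (p.continuous.smul (continuous_leftShift_density q)).integrable_of_hasCompactSupport
      p.hasCompactSupport.smul_right
  ext φ
  rw [ContinuousLinearMap.integral_apply hR, ContinuousLinearMap.integral_apply hL]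
  have h1 : ∀ y, (q y • rightShift y (density p)) φ =
      ∫ x, q y * (p x * φ (x * y)) ∂(haar : Measure G) := fun y => by
    rw [integral_const_mul]; rfl
  have h2 : ∀ x, (p x • leftShift x (density q)) φ =
      ∫ y, q y * (p x * φ (x * y)) ∂(haar : Measure G) := fun x => by
    simp only [mul_left_comm (q _) (p x)]
    rw [integral_const_mul]; rfl
  simp only [h1, h2]
  -- Compact support replaces the σ-finiteness of Haar measure in Fubini's theorem.
  refine integral_integral_swap_of_hasCompactSupport (f := fun y x => q y * (p x * φ (x * y))) ?_ ?_
  · exact (q.continuous.comp continuous_fst).mul ((p.continuous.comp continuous_snd).mul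
      (φ.continuous.comp (continuous_snd.mul continuous_fst)))
  · refine HasCompactSupport.intro (q.hasCompactSupport.prod p.hasCompactSupport) fun z hz => ?_
    change q z.1 * (p z.2 * φ (z.2 * z.1)) = 0
    rw [Set.mem_prod, not_and_or] at hz
    rcases hz with hz | hz
    · rw [image_eq_zero_of_notMem_tsupport hz, zero_mul]
    · rw [image_eq_zero_of_notMem_tsupport hz, zero_mul, mul_zero]

/-- A continuous function whose integral against every function in `C_c(G)` vanishes is zero. -/
lemma eq_zero_of_integral_mul_eq_zero {F : G → ℝ} (hF : Continuous F)
    (h : ∀ p : CompactlySupportedContinuousMap G ℝ, ∫ x, p x * F x ∂(haar : Measure G) = 0)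
    (x₀ : G) : F x₀ = 0 := by
  obtain ⟨f, hfc, hf0, hf1⟩ := exists_continuous_nonneg_pos x₀
  have h0 := h ⟨⟨fun x => f x * F x, f.continuous.mul hF⟩, hfc.mul_right⟩
  by_contra hne
  have hpos : 0 < ∫ x, f x * (F x * F x) ∂(haar : Measure G) :=
    (f.continuous.mul (hF.mul hF)).integral_pos_of_hasCompactSupport_nonneg_nonzero hfc.mul_right
      (fun x => mul_nonneg (hf0 x) (mul_self_nonneg _))
      (mul_ne_zero hf1 (mul_ne_zero hne hne))
  refine hpos.ne' ?_
  rw [← h0]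
  exact integral_congr_ae (.of_forall fun x => (mul_assoc _ _ _).symm)

/-- A functional that is invariant under right translations of `C_c(G)` is invariant under left
translations. -/
lemma left_invariant_of_right_invariant (ℓ : CbDual G →L[ℝ] ℝ)
    (hℓ : ∀ g (p : CompactlySupportedContinuousMap G ℝ), ℓ (rightShift g (density p)) = ℓ (density p))
    (h : G) (q : CompactlySupportedContinuousMap G ℝ) :
    ℓ (leftShift h (density q)) = ℓ (density q) := by
  -- Apply `ℓ` to both forms of the convolution. Right invariance turns the first into the mass of
  -- `q` times `ℓ(p)`, so the second depends on `q` only through its mass.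
  have key : ∀ p q : CompactlySupportedContinuousMap G ℝ,
      density q Cb.one * ℓ (density p) =
        ∫ x, p x * ℓ (leftShift x (density q)) ∂(haar : Measure G) := by
    intro p q
    have hR : Integrable (fun y => q y • rightShift y (density p)) (haar : Measure G) :=
      (q.continuous.smul (continuous_rightShift_density p)).integrable_of_hasCompactSupport
        q.hasCompactSupport.smul_right
    have hL : Integrable (fun x => p x • leftShift x (density q)) (haar : Measure G) :=
      (p.continuous.smul (continuous_leftShift_density q)).integrable_of_hasCompactSupport
        p.hasCompactSupport.smul_right
    have h1 := congrArg ℓ (integral_rightShift_eq_integral_leftShift p q)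
    rw [← ContinuousLinearMap.integral_comp_comm ℓ hR,
      ← ContinuousLinearMap.integral_comp_comm ℓ hL] at h1
    simp only [map_smul, hℓ, smul_eq_mul] at h1
    rw [← h1, integral_mul_const, density_apply]
    congr 1
    exact integral_congr_ae (.of_forall fun x => mul_one _)
  have hc : ∀ q : CompactlySupportedContinuousMap G ℝ,
      Continuous fun x => ℓ (leftShift x (density q)) := fun q =>
    ℓ.continuous.comp (continuous_leftShift_density q)
  -- A left translate of `q` has the same mass as `q`, so both continuous functions of `x` have
  -- equal integrals against every `p`; they therefore agree at `x = 1`.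
  have hz := eq_zero_of_integral_mul_eq_zero
    (F := fun x => ℓ (leftShift x (density (leftTranslate h q))) - ℓ (leftShift x (density q)))
    ((hc _).sub (hc _)) (fun p => by
      simp only [mul_sub]
      rw [integral_sub (integrable_mul_bounded p (hc _)) (integrable_mul_bounded p (hc _)),
        ← key, ← key, ← leftShift_density, leftShift_apply_one, sub_self]) 1
  have h1 : ∀ T : CbDual G, leftShift 1 T = T := fun T => by
    ext φ
    change T _ = T _
    congr 1
    ext x
    exact congrArg φ (one_mul x)
  rw [h1, h1, ← leftShift_density] at hz
  exact sub_eq_zero.mp hz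

/-- If `G` is amenable, convex combinations of the right translates of a density are almost
invariant under any finite set of left translations. -/
lemma exists_finite_almost_invariant (hG : IsAmenable G) (p : CompactlySupportedContinuousMap G ℝ)
    {ι : Type} [Fintype ι] (h : ι → G) {ε : ℝ} (hε : 0 < ε) :
    ∃ T ∈ convexHull ℝ (Set.range fun g => rightShift g (density p)),
      ∀ i, ‖leftShift (h i) T - T‖ < ε := by
  classical
  obtain ⟨m, hm, hm1, hminv⟩ := hG
  by_contra! hcon
  let Ψ : CbDual G →ₗ[ℝ] (ι → CbDual G) :=
    { toFun := fun T i => leftShift (h i) T - T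
      map_add' := fun S T => by
        funext i
        change leftShift (h i) (S + T) - (S + T) = (leftShift (h i) S - S) + (leftShift (h i) T - T)
        rw [leftShift_add]; abel
      map_smul' := fun c T => by
        funext i
        change leftShift (h i) (c • T) - c • T = c • (leftShift (h i) T - T)
        rw [leftShift_smul, smul_sub] }
  have hdisj : Disjoint (Metric.ball (0 : ι → CbDual G) ε)
      (Ψ '' convexHull ℝ (Set.range fun g => rightShift g (density p))) := by
    rw [Set.disjoint_left]
    rintro _ hx ⟨T, hT, rfl⟩
    obtain ⟨i, hi⟩ := hcon T hT
    rw [mem_ball_zero_iff] at hx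
    exact absurd ((norm_le_pi_norm (Ψ T) i).trans_lt hx) (not_lt.mpr hi)
  -- If no convex combination is almost invariant, the displacements `Ψ T` avoid a ball about zero,
  -- and some functional `f` is at least `δ > 0` on all of them.
  obtain ⟨f, δ, hf1, hf2⟩ := geometric_hahn_banach_open (convex_ball _ _) Metric.isOpen_ball
    ((convex_convexHull ℝ _).linear_image Ψ) hdisj
  have hδ : 0 < δ := by
    have := hf1 0 (Metric.mem_ball_self hε)
    rwa [map_zero] at this
  let Λ : ι → CbDual G →L[ℝ] ℝ := fun i => f ∘L ContinuousLinearMap.single ℝ (fun _ => CbDual G) i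
  have hΛ : ∀ x : ι → CbDual G, f x = ∑ i, Λ i (x i) := fun x => by
    conv_lhs => rw [← Finset.univ_sum_single x, _root_.map_sum]
    rfl
  -- Averaging each component of `f` over right translates gives `ℓ i`. It is right invariant on
  -- densities because `m` is left invariant: the orbit function of `R_g T` at `x` is that of `T` at
  -- `g x`.
  choose ℓ hℓ using fun i => exists_average hm hm1 (Λ i)
  have hright : ∀ i g (q : CompactlySupportedContinuousMap G ℝ),
      ℓ i (rightShift g (density q)) = ℓ i (density q) := by
    intro i g q
    have hq := density_mem_rightContinuous q
    have hgq : rightShift g (density q) ∈ rightContinuous G := by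
      change Continuous fun x => rightShift x (rightShift g (density q))
      simp only [rightShift_mul]
      exact (continuous_rightShift_density q).comp (continuous_const_mul g)
    have e1 := hℓ i ⟨_, hgq⟩
    have e2 := hℓ i ⟨_, hq⟩
    rw [e1, e2, ← hminv g⁻¹ (orbitFunction (Λ i) ⟨_, hq⟩)]
    congr 1
    ext x
    change Λ i (rightShift x (rightShift g (density q))) =
      Λ i (rightShift (g⁻¹⁻¹ * x) (density q))
    rw [rightShift_mul, inv_inv]
  have hzero : m (∑ i, (orbitFunction (Λ i) ⟨_, density_mem_rightContinuous (leftTranslate (h i) p)⟩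
      - orbitFunction (Λ i) ⟨_, density_mem_rightContinuous p⟩)) = 0 := by
    rw [_root_.map_sum]
    refine Finset.sum_eq_zero fun i _ => ?_
    rw [map_sub, ← hℓ, ← hℓ]
    change ℓ i (density (leftTranslate (h i) p)) - ℓ i (density p) = 0
    rw [← leftShift_density, left_invariant_of_right_invariant (ℓ i) (hright i), sub_self]
  -- The bound `δ ≤ f(Ψ(R_g p))` holds for every `g`, while the mean over `g` of the right side
  -- vanishes by left invariance of the `ℓ i`.
  have hge : δ ≤ 0 := by
    rw [← hzero, ← mean_const hm1 δ]
    refine mean_mono hm fun g => ?_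
    have := hf2 (Ψ (rightShift g (density p))) ⟨_, subset_convexHull ℝ _ ⟨g, rfl⟩, rfl⟩
    rw [hΛ] at this
    refine this.trans (le_of_eq ?_)
    rw [BoundedContinuousFunction.coe_sum, Finset.sum_apply]
    refine Finset.sum_congr rfl fun i _ => ?_
    rw [BoundedContinuousFunction.sub_apply, orbitFunction_apply, orbitFunction_apply]
    change Λ i (leftShift (h i) (rightShift g (density p)) - rightShift g (density p)) =
      Λ i (rightShift g (density (leftTranslate (h i) p))) - Λ i (rightShift g (density p))
    rw [map_sub, leftShift_rightShift, leftShift_density]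
  linarith

/-- Reiter's property: an amenable group has probability densities in `C_c(G)` that are almost
invariant under compact sets of left translations. -/
lemma exists_almost_invariant (hG : IsAmenable G) {K : Set G} (hK : IsCompact K) {ε : ℝ}
    (hε : 0 < ε) :
    ∃ p : CompactlySupportedContinuousMap G ℝ, (∀ x, 0 ≤ p x) ∧
      ∫ x, p x ∂(haar : Measure G) = 1 ∧
      ∀ h ∈ K, ∫ x, |p (h⁻¹ * x) - p x| ∂(haar : Measure G) ≤ ε := by
  obtain ⟨p₀, hp₀, hp₁⟩ := exists_density_one G
  let N : Set G := {n | ‖leftShift n (density p₀) - density p₀‖ < ε / 2}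
  have hN : IsOpen N := isOpen_lt
    (continuous_norm.comp ((continuous_leftShift_density p₀).sub continuous_const)) continuous_const
  have h1N : (1 : G) ∈ N := by
    have : leftShift 1 (density p₀) = density p₀ := by
      rw [leftShift_density]
      congr 1
      ext x
      change p₀ (1⁻¹ * x) = p₀ x
      rw [inv_one, one_mul]
    change ‖leftShift 1 (density p₀) - density p₀‖ < ε / 2
    rw [this, sub_self]
    exact (norm_zero (E := CbDual G)).trans_lt (half_pos hε)
  obtain ⟨t, -, ht⟩ := hK.elim_nhds_subcover (fun h => {x | h⁻¹ * x ∈ N}) fun h _ =>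
    (hN.preimage (continuous_const_mul h⁻¹)).mem_nhds (by
      change h⁻¹ * h ∈ N
      rwa [inv_mul_cancel])
  obtain ⟨T, hT, hTt⟩ := exists_finite_almost_invariant hG p₀
    (fun i : Fin t.card => ((t.equivFin.symm i : t) : G)) (half_pos hε)
  have hTt' : ∀ h ∈ t, ‖leftShift h T - T‖ < ε / 2 := fun h hh => by
    have := hTt (t.equivFin ⟨h, hh⟩)
    rwa [Equiv.symm_apply_apply] at this
  -- The estimate defining `N` concerns `p₀` only. Right translations are contractions commuting
  -- with left ones and balls are convex, so it holds on the whole hull, uniformly in the choice of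
  -- `T`; hence `N` can be fixed before `T`.
  have hTN : ∀ n ∈ N, ‖leftShift n T - T‖ < ε / 2 := by
    intro n hn
    refine convexHull_min (t := {T | ‖leftShift n T - T‖ < ε / 2}) ?_ ?_ hT
    · rintro _ ⟨g, rfl⟩
      change ‖leftShift n (rightShift g (density p₀)) - rightShift g (density p₀)‖ < ε / 2
      rw [leftShift_rightShift, ← rightShift_sub]
      exact (norm_rightShift_le g _).trans_lt hn
    · intro S hS S' hS' a b ha hb hab
      change ‖leftShift n (a • S + b • S') - (a • S + b • S')‖ < ε / 2
      have : leftShift n (a • S + b • S') - (a • S + b • S') =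
          a • (leftShift n S - S) + b • (leftShift n S' - S') := by
        rw [leftShift_add, leftShift_smul, leftShift_smul, smul_sub, smul_sub]; abel
      rw [this, ← mem_ball_zero_iff (E := CbDual G)]
      exact convex_ball (0 : CbDual G) (ε / 2) (mem_ball_zero_iff.mpr hS)
        (mem_ball_zero_iff.mpr hS') ha hb hab
  obtain ⟨p, hpT, hp0, hp1⟩ : ∃ p : CompactlySupportedContinuousMap G ℝ, density p = T ∧
      (∀ x, 0 ≤ p x) ∧ density p Cb.one = 1 := by
    refine convexHull_min (t := {T | ∃ p : CompactlySupportedContinuousMap G ℝ, density p = T ∧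
      (∀ x, 0 ≤ p x) ∧ density p Cb.one = 1}) ?_ ?_ hT
    · rintro _ ⟨g, rfl⟩
      obtain ⟨c, hc, hcp⟩ := exists_rightShift_density g
      refine ⟨c • rightTranslate g p₀, by rw [density_smul, ← hcp],
        fun x => mul_nonneg hc (hp₀ _), ?_⟩
      rw [density_smul, ← hcp, rightShift_apply_one, hp₁]
    · rintro _ ⟨p, rfl, hp, hp1⟩ _ ⟨q, rfl, hq, hq1⟩ a b ha hb hab
      have he : density (a • p + b • q) = a • density p + b • density q := by
        rw [density_add, density_smul, density_smul]
      refine ⟨a • p + b • q, he,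
        fun x => add_nonneg (mul_nonneg ha (hp x)) (mul_nonneg hb (hq x)), ?_⟩
      rw [he, _root_.add_apply, _root_.smul_apply, _root_.smul_apply, hp1, hq1, smul_eq_mul,
        smul_eq_mul, mul_one, mul_one, hab]
  refine ⟨p, hp0, ?_, fun h hh => ?_⟩
  · rw [← hp1, density_apply]
    exact integral_congr_ae (.of_forall fun x => (mul_one _).symm)
  obtain ⟨k, hk, hkh⟩ := Set.mem_iUnion₂.mp (ht hh)
  -- Write `h = k (k⁻¹ h)` with `k` in the finite set `t` and `k⁻¹ h ∈ N`; each factor contributes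
  -- `ε / 2`.
  have hsplit : leftShift h T - T = leftShift k (leftShift (k⁻¹ * h) T - T) +
      (leftShift k T - T) := by
    rw [leftShift_sub, ← leftShift_mul, mul_inv_cancel_left]; abel
  have hlt : ‖leftShift h T - T‖ ≤ ε := by
    rw [hsplit]
    calc _ ≤ ‖leftShift k (leftShift (k⁻¹ * h) T - T)‖ + ‖leftShift k T - T‖ := norm_add_le _ _
      _ ≤ ε / 2 + ε / 2 :=
        add_le_add ((norm_leftShift_le k _).trans (hTN _ hkh).le) (hTt' k hk).le
      _ = ε := add_halves ε
  refine le_trans ?_ hlt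
  rw [← hpT, leftShift_density, ← density_sub]
  exact integral_abs_le_norm_density (leftTranslate h p - p)

end Reiter

/-! ### Fell absorption by almost invariant vectors -/

section Fell

open scoped Topology

variable {G : Type u} [Group G] [TopologicalSpace G] [IsTopologicalGroup G] [LocallyCompactSpace G]
  [MeasurableSpace G] [BorelSpace G]

/-- Converts `L¹` almost invariance of a density into `L²` almost invariance of its square root. -/
lemma sq_sqrt_sub_sqrt_le {a b : ℝ} (ha : 0 ≤ a) (hb : 0 ≤ b) : (√a - √b) ^ 2 ≤ |a - b| := by
  have h1 : |a - b| = |√a - √b| * (√a + √b) := by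
    rw [← abs_of_nonneg (add_nonneg (Real.sqrt_nonneg a) (Real.sqrt_nonneg b)), ← abs_mul]
    congr 1
    nlinarith [Real.mul_self_sqrt ha, Real.mul_self_sqrt hb]
  have h2 : |√a - √b| ≤ √a + √b :=
    abs_le.mpr ⟨by linarith [Real.sqrt_nonneg a], by linarith [Real.sqrt_nonneg b]⟩
  rw [h1, ← sq_abs, sq]
  exact mul_le_mul_of_nonneg_left h2 (abs_nonneg _)

lemma integrable_sq (f : CompactlySupportedContinuousMap G ℝ) :
    Integrable (fun x => f x ^ 2) (haar : Measure G) :=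
  (f.continuous.pow 2).integrable_of_hasCompactSupport
    (f.hasCompactSupport.mono fun x hx h => hx (by simp [h]))

/-- An amenable group has unit vectors in `L²(G)` that are almost invariant on compact sets. -/
lemma exists_almost_invariant_unit (hG : IsAmenable G) {K : Set G} (hK : IsCompact K) {ε : ℝ}
    (hε : 0 < ε) :
    ∃ f : CompactlySupportedContinuousMap G ℝ, ∫ x, f x ^ 2 ∂(haar : Measure G) = 1 ∧
      ∀ h ∈ K, ∫ x, (leftTranslate h f - f) x ^ 2 ∂(haar : Measure G) ≤ ε := by
  obtain ⟨p, hp0, hp1, hpK⟩ := exists_almost_invariant hG hK hε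
  let f : CompactlySupportedContinuousMap G ℝ := ⟨⟨fun x => √(p x), p.continuous.sqrt⟩,
    p.hasCompactSupport.comp_left Real.sqrt_zero⟩
  refine ⟨f, ?_, fun h hh => (integral_mono (integrable_sq _)
    (integrable_compactlySupported (leftTranslate h p - p)).abs fun x => ?_).trans (hpK h hh)⟩
  · rw [← hp1]
    exact integral_congr_ae (.of_forall fun x => Real.sq_sqrt (hp0 x))
  · exact sq_sqrt_sub_sqrt_le (hp0 _) (hp0 _)

variable {H : Type u} [NormedAddCommGroup H] [InnerProductSpace ℂ H] [CompleteSpace H]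

lemma L2.norm_sq_eq_integral (ξ : L2 G H) : ‖ξ‖ ^ 2 = ∫ g, ‖ξ g‖ ^ 2 ∂(haar : Measure G) := by
  have h1 : inner ℂ ξ ξ = ((‖ξ‖ ^ 2 : ℝ) : ℂ) := by
    rw [inner_self_eq_norm_sq_to_K, RCLike.ofReal_eq_complex_ofReal, Complex.ofReal_pow]
  rw [MeasureTheory.L2.inner_def] at h1
  simp only [inner_self_eq_norm_sq_to_K, RCLike.ofReal_eq_complex_ofReal, ← Complex.ofReal_pow] at h1
  rw [integral_complex_ofReal] at h1
  exact (Complex.ofReal_injective h1).symm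

namespace UnitaryRep

lemma memLp_twist (W : UnitaryRep G H) (f : CompactlySupportedContinuousMap G ℝ) (v : H) :
    MemLp (fun g => (f g : ℂ) • (W.U g⁻¹ : H →L[ℂ] H) v) 2 (haar : Measure G) := by
  have hc : Continuous fun g => (f g : ℂ) • (W.U g⁻¹ : H →L[ℂ] H) v :=
    (Complex.continuous_ofReal.comp f.continuous).smul
      ((W.strong_continuous v).comp continuous_inv)
  refine hc.memLp_of_hasCompactSupport ?_
  exact f.hasCompactSupport.mono fun g hg h => hg (by simp [h])

/-- The vectors `g ↦ f(g) U_g⁻¹ v`, as a linear map in `v`. -/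
def twistₗ (W : UnitaryRep G H) (f : CompactlySupportedContinuousMap G ℝ) : H →ₗ[ℂ] L2 G H where
  toFun v := (W.memLp_twist f v).toLp _
  map_add' v w := by
    rw [← MemLp.toLp_add, MemLp.toLp_eq_toLp_iff]
    exact .of_forall fun g => by
      change (f g : ℂ) • (W.U g⁻¹ : H →L[ℂ] H) (v + w) =
        (f g : ℂ) • (W.U g⁻¹ : H →L[ℂ] H) v + (f g : ℂ) • (W.U g⁻¹ : H →L[ℂ] H) w
      rw [map_add, smul_add]
  map_smul' c v := by
    rw [RingHom.id_apply, ← MemLp.toLp_const_smul, MemLp.toLp_eq_toLp_iff]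
    exact .of_forall fun g => by
      change (f g : ℂ) • (W.U g⁻¹ : H →L[ℂ] H) (c • v) =
        c • (f g : ℂ) • (W.U g⁻¹ : H →L[ℂ] H) v
      rw [map_smul, smul_comm]

lemma twistₗ_ae_eq (W : UnitaryRep G H) (f : CompactlySupportedContinuousMap G ℝ) (v : H) :
    W.twistₗ f v =ᵐ[haar] fun g => (f g : ℂ) • (W.U g⁻¹ : H →L[ℂ] H) v :=
  MemLp.coeFn_toLp (W.memLp_twist f v)

lemma norm_twistₗ (W : UnitaryRep G H) (f : CompactlySupportedContinuousMap G ℝ) (v : H) :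
    ‖W.twistₗ f v‖ = √(∫ x, f x ^ 2 ∂(haar : Measure G)) * ‖v‖ := by
  rw [← Real.sqrt_sq (norm_nonneg v), ← Real.sqrt_mul (integral_nonneg fun _ => sq_nonneg _),
    ← Real.sqrt_sq (norm_nonneg (W.twistₗ f v)), L2.norm_sq_eq_integral, ← integral_mul_const]
  congr 1
  refine integral_congr_ae ?_
  filter_upwards [W.twistₗ_ae_eq f v] with g hg
  rw [hg, norm_smul, norm_unitary_apply, mul_pow, Complex.norm_real, Real.norm_eq_abs, sq_abs]

/-- The vectors `g ↦ f(g) U_g⁻¹ v`, as a bounded operator in `v`. -/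
def twist (W : UnitaryRep G H) (f : CompactlySupportedContinuousMap G ℝ) : H →L[ℂ] L2 G H :=
  (W.twistₗ f).mkContinuous _ fun v => (W.norm_twistₗ f v).le

lemma twist_ae_eq (W : UnitaryRep G H) (f : CompactlySupportedContinuousMap G ℝ) (v : H) :
    W.twist f v =ᵐ[haar] fun g => (f g : ℂ) • (W.U g⁻¹ : H →L[ℂ] H) v :=
  W.twistₗ_ae_eq f v

lemma norm_twist (W : UnitaryRep G H) (f : CompactlySupportedContinuousMap G ℝ) (v : H) :
    ‖W.twist f v‖ = √(∫ x, f x ^ 2 ∂(haar : Measure G)) * ‖v‖ :=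
  W.norm_twistₗ f v

lemma twist_sub (W : UnitaryRep G H) (f f' : CompactlySupportedContinuousMap G ℝ) (v : H) :
    W.twist (f - f') v = W.twist f v - W.twist f' v := by
  refine Lp.ext ?_
  filter_upwards [W.twist_ae_eq (f - f') v, W.twist_ae_eq f v, W.twist_ae_eq f' v,
    Lp.coeFn_sub (W.twist f v) (W.twist f' v)] with g h1 h2 h3 h4
  rw [h1, h4, Pi.sub_apply, h2, h3, ← sub_smul, CompactlySupportedContinuousMap.sub_apply,
    Complex.ofReal_sub]

/-- Fell's absorption identity: `(h⁻¹ g)⁻¹ = g⁻¹ h`, so translating the argument by `h` releases the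
operator `U_h`. -/
lemma leftRegular_twist (W : UnitaryRep G H) (f : CompactlySupportedContinuousMap G ℝ) (h : G)
    (v : H) : ((leftRegular H).U h : L2 G H →L[ℂ] L2 G H) (W.twist f v) =
      W.twist (leftTranslate h f) ((W.U h : H →L[ℂ] H) v) := by
  rw [leftRegular_apply]
  refine Lp.ext ?_
  have hq : QuasiMeasurePreserving (fun g : G => h⁻¹ * g) haar haar :=
    (measurePreserving_mul_left haar h⁻¹).quasiMeasurePreserving
  filter_upwards [leftTranslation_ae_eq h (W.twist f v), hq.ae (W.twist_ae_eq f v),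
    W.twist_ae_eq (leftTranslate h f) ((W.U h : H →L[ℂ] H) v)] with g h1 h2 h3
  rw [h1, h2, h3, mul_inv_rev, inv_inv, map_mul W.U]
  rfl

lemma integrable_smul_comp (W : UnitaryRep G H) (k : CompactlySupportedContinuousMap G ℂ)
    {γ : G → G} (hγ : Continuous γ) (v : H) :
    Integrable (fun h => k h • (W.U (γ h) : H →L[ℂ] H) v) (haar : Measure G) :=
  (k.continuous.smul ((W.strong_continuous v).comp hγ)).integrable_of_hasCompactSupport
    k.hasCompactSupport.smul_right

/-- Integrated operators of the left regular representation almost intertwine with those of `W`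
on twisted vectors, if `f` is almost invariant. -/
lemma norm_integral_twist_sub_le (W : UnitaryRep G H) (k : CompactlySupportedContinuousMap G ℂ)
    {γ : G → G} (hγ : Continuous γ) (f : CompactlySupportedContinuousMap G ℝ) {ε : ℝ}
    (hf : ∀ h ∈ tsupport k,
      ∫ x, (leftTranslate (γ h) f - f) x ^ 2 ∂(haar : Measure G) ≤ ε) (v : H) :
    ‖(∫ h, k h • ((leftRegular H).U (γ h) : L2 G H →L[ℂ] L2 G H) (W.twist f v)
        ∂(haar : Measure G)) -
      W.twist f (∫ h, k h • (W.U (γ h) : H →L[ℂ] H) v ∂(haar : Measure G))‖ ≤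
      (∫ h, ‖k h‖ ∂(haar : Measure G)) * (√ε * ‖v‖) := by
  rw [← ContinuousLinearMap.integral_comp_comm _ (W.integrable_smul_comp k hγ v),
    ← integral_sub ((leftRegular H).integrable_smul_comp k hγ _)
      ((W.twist f).integrable_comp (W.integrable_smul_comp k hγ v)), ← integral_mul_const]
  refine norm_integral_le_of_norm_le ((integrable_coe k).norm.mul_const _) (.of_forall fun h => ?_)
  rw [map_smul, leftRegular_twist, ← smul_sub, ← twist_sub, norm_smul, norm_twist,
    norm_unitary_apply]
  by_cases hh : h ∈ tsupport k
  · gcongr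
    exact hf h hh
  · rw [image_eq_zero_of_notMem_tsupport hh, norm_zero, zero_mul, zero_mul]

/-- Keeping the inverse on the unitary avoids the modular function. Adjoints are thus covered by
`norm_integral_twist_sub_le` with `γ` the inversion. -/
lemma adjoint_integrated_apply (W : UnitaryRep G H) (k : CompactlySupportedContinuousMap G ℂ)
    (v : H) : star (W.integrated k) v =
      ∫ h, star (k h) • (W.U h⁻¹ : H →L[ℂ] H) v ∂(haar : Measure G) := by
  have hint : Integrable (fun h => star (k h) • (W.U h⁻¹ : H →L[ℂ] H) v) (haar : Measure G) :=
    (k.continuous.star.smul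
      ((W.strong_continuous v).comp continuous_inv)).integrable_of_hasCompactSupport
      (k.hasCompactSupport.comp_left (g := star) (star_zero ℂ)).smul_right
  refine ext_inner_left ℂ fun w => ?_
  rw [ContinuousLinearMap.star_eq_adjoint, ContinuousLinearMap.adjoint_inner_right,
    ← integral_inner hint, ← inner_conj_symm, integrated_apply,
    ← integral_inner (W.integrable_smul k w), ← integral_conj]
  refine integral_congr_ae (.of_forall fun h => ?_)
  change (starRingEnd ℂ) (inner ℂ v (k h • (W.U h : H →L[ℂ] H) w)) =
    inner ℂ w (star (k h) • (W.U h⁻¹ : H →L[ℂ] H) v)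
  rw [inner_conj_symm, inner_smul_left, inner_smul_right, ← W.star_apply,
    ContinuousLinearMap.star_eq_adjoint, ContinuousLinearMap.adjoint_inner_right]
  rfl

end UnitaryRep

/-- Covariance gives `π(α_{g⁻¹}(a)) U_{g⁻¹} v = U_{g⁻¹} π(a) v` at every `g`, so this intertwining
is exact and needs no invariance of `f`. -/
lemma CovariantRep.induced_twist {A : Type u} [NonUnitalCStarAlgebra A] {α : G →* (A ≃⋆ₐ[ℂ] A)}
    (W : CovariantRep α H) (a : A) (f : CompactlySupportedContinuousMap G ℝ) (v : H)
    (h : W.toUnitaryRep.twist f v ∈ (induced α W.π a).domain) :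
    induced α W.π a ⟨W.toUnitaryRep.twist f v, h⟩ = W.toUnitaryRep.twist f (W.π a v) := by
  refine Lp.ext ?_
  filter_upwards [induced_ae_eq α W.π a ⟨_, h⟩, W.toUnitaryRep.twist_ae_eq f v,
    W.toUnitaryRep.twist_ae_eq f (W.π a v)] with g h1 h2 h3
  have h4 := W.toUnitaryRep.inv_apply_apply g⁻¹ v
  rw [inv_inv] at h4
  rw [h1, h3]
  change W.π (α g⁻¹ a) (W.toUnitaryRep.twist f v g) = _
  rw [h2, map_smul, W.π_act, h4]

/-- For amenable `G` there are isometries `H → L²(G, H)` that asymptotically intertwine a unitary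
representation with the left regular representation, and intertwine `π` with `π̃`. -/
lemma exists_twist_net (hG : IsAmenable G) (W : UnitaryRep G H) :
    ∃ f : ℕ × TopologicalSpace.Compacts G → CompactlySupportedContinuousMap G ℝ,
      (∀ i v, ‖W.twist (f i) v‖ = ‖v‖) ∧ ∀ (l : GroupCStar G) (v : H),
        Filter.Tendsto (fun i => ‖(leftRegular H).cstarRep l (W.twist (f i) v) -
          W.twist (f i) (W.cstarRep l v)‖) Filter.atTop (𝓝 0) := by
  -- The index `(n, K)` asks for tolerance `1 / (n + 1)` on the compact set `K`.
  choose f hf1 hf using fun i : ℕ × TopologicalSpace.Compacts G =>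
    exists_almost_invariant_unit hG i.2.isCompact (ε := 1 / (i.1 + 1 : ℝ)) (by positivity)
  have hV : ∀ i v, ‖W.twist (f i) v‖ = ‖v‖ := fun i v => by
    rw [W.norm_twist, hf1, Real.sqrt_one, one_mul]
  refine ⟨f, hV, fun l => ?_⟩
  let P : BddFamilies G →⋆ₙₐ[ℂ] (H →L[ℂ] H) := BddFamilies.proj G ⟨H, W⟩
  let Q : BddFamilies G →⋆ₙₐ[ℂ] (L2 G H →L[ℂ] L2 G H) :=
    BddFamilies.proj G ⟨L2 G H, leftRegular H⟩
  have hP : ∀ x, ‖P x‖ ≤ ‖x‖ := BddFamilies.norm_proj_le _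
  have hQ : ∀ x, ‖Q x‖ ≤ ‖x‖ := BddFamilies.norm_proj_le _
  let D : BddFamilies G → ℕ × TopologicalSpace.Compacts G → H → L2 G H := fun x i v =>
    Q x (W.twist (f i) v) - W.twist (f i) (P x v)
  let Good : BddFamilies G → Prop := fun x =>
    ∀ v, Filter.Tendsto (fun i => ‖D x i v‖) Filter.atTop (𝓝 0)
  -- The twists are isometric, so replacing `x` by `y` changes the defect by at most `2 ‖x - y‖
  -- ‖v‖`, uniformly in the index.
  have hclosed : IsClosed {x | Good x} := by
    refine isClosed_of_closure_subset fun x hx v => ?_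
    rw [Metric.tendsto_atTop]
    intro ε hε
    obtain ⟨y, hy, hxy⟩ := Metric.mem_closure_iff.mp hx (ε / 4 / (‖v‖ + 1)) (by positivity)
    obtain ⟨i₀, hi₀⟩ := Metric.tendsto_atTop.mp (hy v) (ε / 2) (half_pos hε)
    refine ⟨i₀, fun i hi => ?_⟩
    have h1 := hi₀ i hi
    rw [dist_zero_right, norm_norm] at h1 ⊢
    rw [dist_eq_norm, lt_div_iff₀ (by positivity)] at hxy
    have h2 : D x i v = D y i v + (Q (x - y) (W.twist (f i) v) - W.twist (f i) (P (x - y) v)) := by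
      simp only [D, map_sub, _root_.sub_apply]; abel
    have h3 : ‖Q (x - y) (W.twist (f i) v)‖ ≤ ‖x - y‖ * ‖v‖ := by
      refine ((Q (x - y)).le_opNorm _).trans ?_
      rw [hV]
      exact mul_le_mul_of_nonneg_right (hQ _) (norm_nonneg _)
    have h4 : ‖W.twist (f i) (P (x - y) v)‖ ≤ ‖x - y‖ * ‖v‖ := by
      rw [hV]
      exact ((P (x - y)).le_opNorm _).trans (mul_le_mul_of_nonneg_right (hP _) (norm_nonneg _))
    have h5 : ‖x - y‖ * ‖v‖ < ε / 4 := lt_of_le_of_lt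
      (mul_le_mul_of_nonneg_left (by linarith) (norm_nonneg _)) hxy
    rw [h2]
    have h6 := norm_add_le (D y i v) (Q (x - y) (W.twist (f i) v) - W.twist (f i) (P (x - y) v))
    have h7 := norm_sub_le (Q (x - y) (W.twist (f i) v)) (W.twist (f i) (P (x - y) v))
    linarith
  have hadd : ∀ x y, Good x → Good y → Good (x + y) := fun x y hx hy v => by
    have h := (hx v).add (hy v)
    rw [add_zero] at h
    refine squeeze_zero (fun _ => norm_nonneg _) (fun i => ?_) h
    have : D (x + y) i v = D x i v + D y i v := by
      simp only [D, map_add, _root_.add_apply]; abel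
    rw [this]
    exact norm_add_le _ _
  have hmul : ∀ x y, Good x → Good y → Good (x * y) := fun x y hx hy v => by
    have h := ((hy v).const_mul ‖Q x‖).add (hx (P y v))
    rw [mul_zero, add_zero] at h
    refine squeeze_zero (fun _ => norm_nonneg _) (fun i => ?_) h
    -- The defect of a product telescopes through the intermediate term `Q x (V (P y v))`, with `V`
    -- the twist.
    have : D (x * y) i v = Q x (D y i v) + D x i (P y v) := by
      simp only [D, map_mul, map_sub, mul_apply_eq_comp]; abel
    rw [this]
    exact (norm_add_le _ _).trans (add_le_add_left ((Q x).le_opNorm _) _)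
  have hsmul : ∀ (c : ℂ) x, Good x → Good (c • x) := fun c x hx v => by
    have h := (hx v).const_mul ‖c‖
    rw [mul_zero] at h
    refine squeeze_zero (fun _ => norm_nonneg _) (fun i => le_of_eq ?_) h
    have : D (c • x) i v = c • D x i v := by
      simp only [D, map_smul, _root_.smul_apply, smul_sub]
    rw [this, norm_smul]
  have hzero : Good 0 := fun v => by
    have : ∀ i, ‖D 0 i v‖ = 0 := fun i => by simp [D]
    simp only [this]
    exact tendsto_const_nhds
  have hest : ∀ (k : CompactlySupportedContinuousMap G ℂ) (γ : G → G), Continuous γ → ∀ v : H,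
      Filter.Tendsto (fun i => ‖(∫ h, k h • ((leftRegular H).U (γ h) : L2 G H →L[ℂ] L2 G H)
        (W.twist (f i) v) ∂(haar : Measure G)) -
        W.twist (f i) (∫ h, k h • (W.U (γ h) : H →L[ℂ] H) v ∂(haar : Measure G))‖)
      Filter.atTop (𝓝 0) := by
    intro k γ hγ v
    have hlim : Filter.Tendsto (fun i : ℕ × TopologicalSpace.Compacts G =>
        (∫ h, ‖k h‖ ∂(haar : Measure G)) * (√(1 / (i.1 + 1 : ℝ)) * ‖v‖)) Filter.atTop (𝓝 0) := by
      have h1 : Filter.Tendsto (fun n : ℕ => √(1 / (n + 1 : ℝ))) Filter.atTop (𝓝 0) := by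
        rw [← Real.sqrt_zero]
        exact (Real.continuous_sqrt.tendsto 0).comp tendsto_one_div_add_atTop_nhds_zero_nat
      have h2 : Filter.Tendsto (fun i : ℕ × TopologicalSpace.Compacts G => i.1)
          Filter.atTop Filter.atTop := by
        rw [← Filter.prod_atTop_atTop_eq]; exact Filter.tendsto_fst
      have h3 := ((h1.comp h2).mul_const ‖v‖).const_mul (∫ h, ‖k h‖ ∂(haar : Measure G))
      rwa [zero_mul, mul_zero] at h3
    let K₀ : TopologicalSpace.Compacts G :=
      ⟨γ '' tsupport k, IsCompact.image k.hasCompactSupport hγ⟩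
    refine squeeze_zero' (.of_forall fun _ => norm_nonneg _) ?_ hlim
    filter_upwards [Filter.eventually_ge_atTop ((0 : ℕ), K₀)] with i hi
    exact W.norm_integral_twist_sub_le k hγ (f i) (fun h hh => hf i _ (hi.2 ⟨h, hh, rfl⟩)) v
  -- Being `Good` is a strong-type convergence and does not visibly pass to adjoints, so the
  -- induction carries `x` and `star x` together.
  have key : Good (GroupCStar.incl G l) ∧ Good (star (GroupCStar.incl G l)) := by
    refine GroupCStar.incl_induction (p := fun x => Good x ∧ Good (star x)) ?_ ?_ ?_ ?_ ?_ ?_ ?_ l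
    · exact hclosed.inter (hclosed.preimage continuous_star)
    · exact ⟨hzero, by rw [star_zero]; exact hzero⟩
    · rintro x y ⟨hx, hx'⟩ ⟨hy, hy'⟩
      exact ⟨hadd x y hx hy, by rw [star_add]; exact hadd _ _ hx' hy'⟩
    · rintro x y ⟨hx, hx'⟩ ⟨hy, hy'⟩
      exact ⟨hmul x y hx hy, by rw [star_mul]; exact hmul _ _ hy' hx'⟩
    · rintro c x ⟨hx, hx'⟩
      exact ⟨hsmul c x hx, by rw [star_smul]; exact hsmul _ _ hx'⟩
    · rintro x ⟨hx, hx'⟩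
      exact ⟨hx', by rw [star_star]; exact hx⟩
    · intro k
      refine ⟨fun v => hest k id continuous_id v, fun v => ?_⟩
      let k' : CompactlySupportedContinuousMap G ℂ := ⟨⟨fun h => star (k h), k.continuous.star⟩,
        k.hasCompactSupport.comp_left (star_zero ℂ)⟩
      have h1 := hest k' (fun h => h⁻¹) continuous_inv v
      refine h1.congr fun i => ?_
      have e1 : ∀ ξ, Q (star (universalIntegrated k)) ξ = ∫ h, k' h •
          ((leftRegular H).U h⁻¹ : L2 G H →L[ℂ] L2 G H) ξ ∂(haar : Measure G) :=
        (leftRegular H).adjoint_integrated_apply k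
      have e2 : P (star (universalIntegrated k)) v = ∫ h, k' h •
          (W.U h⁻¹ : H →L[ℂ] H) v ∂(haar : Measure G) := W.adjoint_integrated_apply k v
      rw [← e1, ← e2]
  exact key.1

end Fell

end CrossedHost

end

/-! ### The norm estimate -/

open CrossedHost
theorem mainTheorem6
    {G : Type u} [Group G] [TopologicalSpace G] [IsTopologicalGroup G] [T2Space G]
    [LocallyCompactSpace G] [MeasurableSpace G] [BorelSpace G]
    {A : Type u} [NonUnitalCStarAlgebra A] [PartialOrder A] [StarOrderedRing A]
    (α : G →* (A ≃⋆ₐ[ℂ] A))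
    {C : Type v} [NonUnitalCStarAlgebra C] (P : CrossedProductHost α C) (hP : P.IsFull)
    (hG : IsAmenable G)
    {H : Type u} [NormedAddCommGroup H] [InnerProductSpace ℂ H] [CompleteSpace H]
    (W : CovariantRep α H) (a : A) (l : GroupCStar G) :
    ‖W.π a * W.cstarRep l‖ ≤
      compNorm (induced α (universalRep A) a) ((leftRegular (UniversalSpace A)).cstarRep l) := by
  set c := compNorm (induced α (universalRep A) a) ((leftRegular (UniversalSpace A)).cstarRep l)
    with hc
  obtain ⟨f, hf, hlim⟩ := exists_twist_net hG W.toUnitaryRep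
  have hdom : ∀ η : L2 G H, η ∈ (induced (G := G) α W.π a).domain := fun η => by
    change η ∈ inducedDomain α W.π a
    rw [W.inducedDomain_eq_top]; trivial
  refine ContinuousLinearMap.opNorm_le_bound _ (compNorm_nonneg _ _) fun v => ?_
  -- Inside `π̃(a)`, the vector `V U_L(l) v` is replaced by `λ_L(l) V v`, where the universal bound
  -- applies; the error is at most `‖a‖` times the defect, which tends to zero along the net.
  have hbound : ∀ i, ‖W.π a (W.cstarRep l v)‖ ≤ c * ‖v‖ + ‖a‖ *
      ‖(leftRegular H).cstarRep l (W.twist (f i) v) - W.twist (f i) (W.cstarRep l v)‖ := by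
    intro i
    set x := W.toUnitaryRep.twist (f i) (W.cstarRep l v) with hx
    set y := (leftRegular H).cstarRep l (W.toUnitaryRep.twist (f i) v) with hy
    have h1 : ‖induced α W.π a ⟨y, hdom y⟩‖ ≤ c * ‖v‖ := by
      have := W.norm_induced_leftRegular_le a l (W.toUnitaryRep.twist (f i) v) (hdom _)
      rwa [hf] at this
    have h2 := norm_induced_apply_le α W.π a ⟨y - x, hdom _⟩
    have h3 : induced α W.π a ⟨x, hdom x⟩ =
        induced α W.π a ⟨y, hdom y⟩ - induced α W.π a ⟨y - x, hdom _⟩ := by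
      rw [← LinearPMap.map_sub]
      congr 1
      exact Subtype.ext (sub_sub_cancel y x).symm
    calc ‖W.π a (W.cstarRep l v)‖ = ‖induced α W.π a ⟨x, hdom x⟩‖ := by
          rw [W.induced_twist, hf]
      _ ≤ ‖induced α W.π a ⟨y, hdom y⟩‖ + ‖induced α W.π a ⟨y - x, hdom _⟩‖ := by
          rw [h3]; exact norm_sub_le _ _
      _ ≤ _ := add_le_add h1 h2
  have h := ((hlim l v).const_mul ‖a‖).const_add (c * ‖v‖)
  rw [mul_zero, add_zero] at h
  exact ge_of_tendsto' h hbound
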